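/- Let $m_1,m_2,m_3>0$ and $\gamma>0$. For $q=(q_1,q_2,q_3)\in\mathbb C^3$ let $\Delta(q)=\tfrac12\,(q_2-q_1)\wedge(q_3-q_1)$ be the signed area of the triangle $q_1q_2q_3$ (where $z\wedge w=\operatorname{Im}(\bar z w)$), let $I(q)=\frac{\sum_{a<b}m_am_b|q_a-q_b|^2}{m_1+m_2+m_3}$ be its moment of inertia, and let $V=-\gamma I/\Delta^2$. Let $q:T\to\mathbb C^3$ be a solution of Newton's equations $m_a\ddot q_a=-\nabla_aV$, $a=1,2,3$, on a nonempty open interval $T\subseteq\mathbb R$, with $\Delta(q(t))\neq0$ for $t\in T$. Write $v=\dot q$, $H=\tfrac12\sum m_a|v_a|^2+V(q)$, $P=\sum m_av_a$, $J=\sum m_a\,q_a\wedge v_a$, and suppose that $H=0$, $P=0$, $J=0$ and $\dot I=\frac{d}{dt}I(q(t))=0$ at some time $t_0\in T$. Let $Z_1=\sqrt{\tfrac{m_1m_2}{m_1+m_2}}\,(q_2-q_1)$ and $Z_2=\sqrt{\tfrac{m_3(m_1+m_2)}{m_1+m_2+m_3}}\,\bigl(q_3-\tfrac{m_1q_1+m_2q_2}{m_1+m_2}\bigr)$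 be the normalized Jacobi vectors, and define the shape space projection $\pi:\mathbb C^3\to\mathbb R^3$ in Hopf–Jacobi coordinates by $$\pi(q)=(w_1,w_2,w_3)=\Bigl(\tfrac12(|Z_1|^2-|Z_2|^2),\ \operatorname{Re}(\bar Z_1Z_2),\ \operatorname{Im}(\bar Z_1Z_2)\Bigr).$$ Put $I_0=I(q(t_0))$. Then there is a hemisphere $S$, either $\{|w|^2=I_0^2/4,\ w_3>0\}$ or $\{|w|^2=I_0^2/4,\ w_3<0\}$, such that the following hold. 1. The curve $t\mapsto\pi(q(t))$, $t\in T$, lies in $S$ and is, up to parametrization, a geodesic of the Jemisphere model of the hyperbolic plane, that is, of $S$ with the metric $|dw|^2/w_3^2$: it is a $C^1$ curve with nowhere vanishing velocity, each of whose sufficiently short arcs has minimal length among the $C^1$ curves in $S$ with the same endpoints. 2. There are $A,B,C\in\mathbb R$ with $(A,B)\neq(0,0)$ such that the curve is contained in the intersection of $S$ with the vertical plane $Aw_1+Bw_2=C$; and if the solution is maximal (not extendable to a larger open time interval), then its projected curve is exactly that intersection. -/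

import Mathlib

noncomputable section

namespace ThreeBody

/-- Configurations of three points in the plane `ℝ² = ℂ`; the same type carries velocities. -/
abbrev Config : Type := Fin 3 → ℂ

/-- The wedge product `z ∧ w` of two planar vectors. -/
def wedge (z w : ℂ) : ℝ := z.re * w.im - z.im * w.re

/-- Signed area of the triangle with vertices `q 0`, `q 1`, `q 2`. -/
def signedArea (q : Config) : ℝ := wedge (q 1 - q 0) (q 2 - q 0) / 2

/-- Moment of inertia about the center of mass,
`(∑_{a < b} m_a m_b |q_a - q_b|²) / ∑_a m_a`. -/
def momentOfInertia (m : Fin 3 → ℝ) (q : Config) : ℝ :=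
  (m 0 * m 1 * ‖q 0 - q 1‖ ^ 2 + m 0 * m 2 * ‖q 0 - q 2‖ ^ 2 + m 1 * m 2 * ‖q 1 - q 2‖ ^ 2)
    / (m 0 + m 1 + m 2)

/-- The potential `V = -γ I / Δ²` (meaningful where `Δ ≠ 0`). -/
def potential (m : Fin 3 → ℝ) (γ : ℝ) (q : Config) : ℝ :=
  -(γ * momentOfInertia m q) / signedArea q ^ 2

/-- The partial gradient `∇_a V`, i.e. the gradient with respect to the position of body `a`. -/
def gradPotential (m : Fin 3 → ℝ) (γ : ℝ) (q : Config) (a : Fin 3) : ℂ :=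
  gradient (fun z : ℂ => potential m γ (Function.update q a z)) (q a)

/-- The velocities `v_a = dq_a/dt`. -/
def velocity (q : ℝ → Config) (t : ℝ) : Config := fun a => deriv (fun s => q s a) t

/-- Kinetic energy `K(v) = ½ ∑ m_a |v_a|²`. -/
def kineticEnergy (m : Fin 3 → ℝ) (v : Config) : ℝ := (∑ a, m a * ‖v a‖ ^ 2) / 2

/-- Total energy `H = K + V`. -/
def energy (m : Fin 3 → ℝ) (γ : ℝ) (q v : Config) : ℝ :=
  kineticEnergy m v + potential m γ q

/-- Linear momentum `P = ∑ m_a v_a`. -/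
def linearMomentum (m : Fin 3 → ℝ) (v : Config) : ℂ := ∑ a, (m a : ℂ) * v a

/-- Angular momentum `J = ∑ m_a q_a ∧ v_a`. -/
def angularMomentum (m : Fin 3 → ℝ) (q v : Config) : ℝ := ∑ a, m a * wedge (q a) (v a)

/-- `q` solves Newton's equations `m_a q̈_a = -∇_a V` on the nonempty open interval `T`
(possibly unbounded), staying in the domain `Δ ≠ 0` of the potential.
Values of `q` outside `T` are irrelevant. -/
structure IsNewtonSolution (m : Fin 3 → ℝ) (γ : ℝ) (T : Set ℝ) (q : ℝ → Config) : Prop where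
  isOpen : IsOpen T
  ordConnected : T.OrdConnected
  nonempty : T.Nonempty
  area_ne_zero : ∀ t ∈ T, signedArea (q t) ≠ 0
  differentiableAt : ∀ t ∈ T, ∀ a, DifferentiableAt ℝ (fun s => q s a) t
  differentiableAt_velocity : ∀ t ∈ T, ∀ a, DifferentiableAt ℝ (fun s => velocity q s a) t
  newton : ∀ t ∈ T, ∀ a,
    (m a : ℂ) * deriv (fun s => velocity q s a) t = -gradPotential m γ (q t) a

/-- A solution that cannot be continued to a larger interval of time. -/
def IsMaximalSolution (m : Fin 3 → ℝ) (γ : ℝ) (T : Set ℝ) (q : ℝ → Config) : Prop :=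
  IsNewtonSolution m γ T q ∧
    ∀ (T' : Set ℝ) (q' : ℝ → Config),
      IsNewtonSolution m γ T' q' → T ⊆ T' → Set.EqOn q q' T → T' = T

/-- First normalized Jacobi vector `√(m₁m₂/(m₁+m₂)) (q₂ - q₁)` (bodies numbered from one). -/
def jacobi₁ (m : Fin 3 → ℝ) (q : Config) : ℂ :=
  (√(m 0 * m 1 / (m 0 + m 1)) : ℝ) * (q 1 - q 0)

/-- Second normalized Jacobi vector
`√(m₃(m₁+m₂)/(m₁+m₂+m₃)) (q₃ - (m₁q₁+m₂q₂)/(m₁+m₂))` (bodies numbered from one). -/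
def jacobi₂ (m : Fin 3 → ℝ) (q : Config) : ℂ :=
  (√(m 2 * (m 0 + m 1) / (m 0 + m 1 + m 2)) : ℝ) *
    (q 2 - ((m 0 : ℂ) * q 0 + (m 1 : ℂ) * q 1) / ((m 0 : ℂ) + (m 1 : ℂ)))

/-- Shape space, with its Hopf-Jacobi coordinates `(w₁, w₂, w₃) = (w 0, w 1, w 2)`. -/
abbrev ShapeSpace : Type := EuclideanSpace ℝ (Fin 3)

/-- The shape space projection in Hopf-Jacobi coordinates: the Hopf map applied to the Jacobi
vectors `Z₁, Z₂`, that is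
`w₁ = (|Z₁|² - |Z₂|²)/2`, `w₂ = Z₁ · Z₂`, `w₃ = Z₁ ∧ Z₂`. -/
def shapeProj (m : Fin 3 → ℝ) (q : Config) : ShapeSpace :=
  !₂[(‖jacobi₁ m q‖ ^ 2 - ‖jacobi₂ m q‖ ^ 2) / 2,
    inner ℝ (jacobi₁ m q) (jacobi₂ m q),
    wedge (jacobi₁ m q) (jacobi₂ m q)]

/-- The open upper hemisphere `|w|² = I₀²/4`, `w₃ > 0`. -/
def upperJemisphere (I₀ : ℝ) : Set ShapeSpace :=
  {w | w 0 ^ 2 + w 1 ^ 2 + w 2 ^ 2 = I₀ ^ 2 / 4 ∧ 0 < w 2}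

/-- The open lower hemisphere `|w|² = I₀²/4`, `w₃ < 0`. -/
def lowerJemisphere (I₀ : ℝ) : Set ShapeSpace :=
  {w | w 0 ^ 2 + w 1 ^ 2 + w 2 ^ 2 = I₀ ^ 2 / 4 ∧ w 2 < 0}

/-- Length of the curve `c` over `[a, b]` for the metric `|dw|² / w₃²`. -/
def jemLength (c : ℝ → ShapeSpace) (a b : ℝ) : ℝ :=
  ∫ t in a..b, ‖derivWithin c (Set.Icc a b) t‖ / |c t 2|

/-- `c`, restricted to the open interval `T`, is an (arbitrarily parametrized) geodesic of the
hemisphere `S` with the metric `|dw|² / w₃²`: a regular `C¹` curve in `S` each of whose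
sufficiently short arcs is a shortest `C¹` curve in `S` between its endpoints. -/
structure IsJemGeodesic (S : Set ShapeSpace) (T : Set ℝ) (c : ℝ → ShapeSpace) : Prop where
  mapsTo : Set.MapsTo c T S
  contDiffOn : ContDiffOn ℝ 1 c T
  regular : ∀ t ∈ T, deriv c t ≠ 0
  locally_minimizing : ∀ t ∈ T, ∃ δ > 0, ∀ a b : ℝ, a < b →
    Set.Icc a b ⊆ T ∩ Set.Ioo (t - δ) (t + δ) →
    ∀ σ : ℝ → ShapeSpace, ContDiffOn ℝ 1 σ (Set.Icc a b) → Set.MapsTo σ (Set.Icc a b) S →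
      σ a = c a → σ b = c b → jemLength c a b ≤ jemLength σ a b

/-- The vertical plane `A w₁ + B w₂ = C`. -/
def verticalPlane (A B C : ℝ) : Set ShapeSpace := {w | A * w 0 + B * w 1 = C}

end ThreeBody

end

open ThreeBody

/-! In Jacobi vectors the problem becomes motion in `ℂ²` with potential `-κI/w₃²`, where `I = |Z₁|²
+ |Z₂|²` and `w₃ = Z₁ ∧ Z₂`. This potential is homogeneous of degree `-2`, so the Lagrange–Jacobi
identity reads `Ï = 4H = 0`. With `İ = 0` at one time, `I` is constant, and the Hopf identity `|w|²
= I²/4` confines the shape curve to a hemisphere.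

The decisive fact is `hopf_affine`: `w₁` and `w₂` are affine in time. Vanishing `J` and `İ` say that
the velocity is Hermitian-orthogonal to `Z`, so in `ℂ²` it equals `λ(-Z̄₂, Z̄₁)`. The quadratic
velocity terms in `ẅ₁`, `ẅ₂` are then negative multiples of `w₁`, `w₂`, and at `H = 0` they cancel
the force terms exactly. The curve therefore lies over a straight line and is an arc of a semicircle
orthogonal to the plane `w₃ = 0`.

Minimality comes from a calibration. A Busemann function has differential of norm at most one for
`|dw|²/w₃²` (`busemannDeriv_le`), so its increment bounds every length from below; along the
semicircle, with center at its initial endpoint, equality holds (`isJemGeodesic_of_affine`).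

For a maximal solution, `w₃²` is a quadratic polynomial in time, positive exactly between two roots
`α < β`. At a time strictly between them the area stays away from zero, the accelerations stay
bounded and the motion continues (`IsNewtonSolution.exists_extension`). Hence `T` is all of `(α, β)`
and the whole semicircle is traced. -/

noncomputable section
namespace ThreeBody

/-! ### Conservation laws and affine Hopf coordinates in `ℂ²` -/

/-- A solution, on `T`, of Newton's equations for the potential `-κ I / w²` on `ℝ⁴ = ℂ²`, where
`I` is the squared norm and `w` is the wedge product of the two planar vectors
`(x₁, y₁)` and `(x₂, y₂)`; the velocities are `(u₁, v₁)` and `(u₂, v₂)`. -/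
structure IsJacobiSolution (κ : ℝ) (T : Set ℝ) (x₁ y₁ x₂ y₂ u₁ v₁ u₂ v₂ : ℝ → ℝ) : Prop where
  wedge_ne_zero : ∀ t ∈ T, x₁ t * y₂ t - y₁ t * x₂ t ≠ 0
  x₁' : ∀ t ∈ T, HasDerivAt x₁ (u₁ t) t
  y₁' : ∀ t ∈ T, HasDerivAt y₁ (v₁ t) t
  x₂' : ∀ t ∈ T, HasDerivAt x₂ (u₂ t) t
  y₂' : ∀ t ∈ T, HasDerivAt y₂ (v₂ t) t
  u₁' : ∀ t ∈ T, HasDerivAt u₁ (2 * κ * (x₁ t / (x₁ t * y₂ t - y₁ t * x₂ t) ^ 2 -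
    (x₁ t ^ 2 + y₁ t ^ 2 + x₂ t ^ 2 + y₂ t ^ 2) * y₂ t / (x₁ t * y₂ t - y₁ t * x₂ t) ^ 3)) t
  v₁' : ∀ t ∈ T, HasDerivAt v₁ (2 * κ * (y₁ t / (x₁ t * y₂ t - y₁ t * x₂ t) ^ 2 +
    (x₁ t ^ 2 + y₁ t ^ 2 + x₂ t ^ 2 + y₂ t ^ 2) * x₂ t / (x₁ t * y₂ t - y₁ t * x₂ t) ^ 3)) t
  u₂' : ∀ t ∈ T, HasDerivAt u₂ (2 * κ * (x₂ t / (x₁ t * y₂ t - y₁ t * x₂ t) ^ 2 +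
    (x₁ t ^ 2 + y₁ t ^ 2 + x₂ t ^ 2 + y₂ t ^ 2) * y₁ t / (x₁ t * y₂ t - y₁ t * x₂ t) ^ 3)) t
  v₂' : ∀ t ∈ T, HasDerivAt v₂ (2 * κ * (y₂ t / (x₁ t * y₂ t - y₁ t * x₂ t) ^ 2 -
    (x₁ t ^ 2 + y₁ t ^ 2 + x₂ t ^ 2 + y₂ t ^ 2) * x₁ t / (x₁ t * y₂ t - y₁ t * x₂ t) ^ 3)) t

theorem eq_of_hasDerivAt_zero {T : Set ℝ} (hT : T.OrdConnected) {f : ℝ → ℝ}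
    (hf : ∀ t ∈ T, HasDerivAt f 0 t) {s t : ℝ} (hs : s ∈ T) (ht : t ∈ T) : f s = f t := by
  have := hT.convex.norm_image_sub_le_of_norm_hasDerivWithin_le (f := f) (f' := fun _ => 0)
    (C := 0) (fun x hx => (hf x hx).hasDerivWithinAt) (by simp) ht hs
  simpa [sub_eq_zero] using this

theorem eq_affine_of_hasDerivAt {T : Set ℝ} (hT : T.OrdConnected) {f g : ℝ → ℝ}
    (hf : ∀ t ∈ T, HasDerivAt f (g t) t) (hg : ∀ t ∈ T, HasDerivAt g 0 t) {t₀ t : ℝ}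
    (ht₀ : t₀ ∈ T) (ht : t ∈ T) : f t = f t₀ + g t₀ * (t - t₀) := by
  have := eq_of_hasDerivAt_zero hT (f := fun s => f s - g t₀ * s) (fun s hs => by
    refine ((hf s hs).fun_sub ((hasDerivAt_id' s).const_mul (g t₀))).congr_deriv ?_
    rw [eq_of_hasDerivAt_zero hT hg hs ht₀]
    ring) ht ht₀
  linarith

namespace IsJacobiSolution

variable {κ : ℝ} {T : Set ℝ} {x₁ y₁ x₂ y₂ u₁ v₁ u₂ v₂ : ℝ → ℝ}

theorem energy_eq_zero (h : IsJacobiSolution κ T x₁ y₁ x₂ y₂ u₁ v₁ u₂ v₂) (hT : T.OrdConnected)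
    {t₀ t : ℝ} (ht₀ : t₀ ∈ T) (ht : t ∈ T)
    (h0 : (u₁ t₀ ^ 2 + v₁ t₀ ^ 2 + u₂ t₀ ^ 2 + v₂ t₀ ^ 2) / 2 -
      κ * (x₁ t₀ ^ 2 + y₁ t₀ ^ 2 + x₂ t₀ ^ 2 + y₂ t₀ ^ 2) /
        (x₁ t₀ * y₂ t₀ - y₁ t₀ * x₂ t₀) ^ 2 = 0) :
    (u₁ t ^ 2 + v₁ t ^ 2 + u₂ t ^ 2 + v₂ t ^ 2) / 2 -
      κ * (x₁ t ^ 2 + y₁ t ^ 2 + x₂ t ^ 2 + y₂ t ^ 2) /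
        (x₁ t * y₂ t - y₁ t * x₂ t) ^ 2 = 0 := by
  rw [← h0]
  refine eq_of_hasDerivAt_zero hT (f := fun t => (u₁ t ^ 2 + v₁ t ^ 2 + u₂ t ^ 2 + v₂ t ^ 2) / 2 -
      κ * (x₁ t ^ 2 + y₁ t ^ 2 + x₂ t ^ 2 + y₂ t ^ 2) /
        (x₁ t * y₂ t - y₁ t * x₂ t) ^ 2) (fun s hs => ?_) ht ht₀
  have hw := h.wedge_ne_zero s hs
  have hK := (((((h.u₁' s hs).fun_pow 2).fun_add ((h.v₁' s hs).fun_pow 2)).fun_add ((h.u₂' s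
      hs).fun_pow 2)).fun_add
    ((h.v₂' s hs).fun_pow 2)).div_const 2
  have hi := (((((h.x₁' s hs).fun_pow 2).fun_add ((h.y₁' s hs).fun_pow 2)).fun_add ((h.x₂' s
      hs).fun_pow 2)).fun_add
    ((h.y₂' s hs).fun_pow 2)).const_mul κ
  have hw' := ((((h.x₁' s hs).fun_mul (h.y₂' s hs)).fun_sub ((h.y₁' s hs).fun_mul (h.x₂' s
      hs))).fun_pow 2)
  refine HasDerivAt.congr_deriv (hK.fun_sub (hi.div hw' (by simpa using hw))) ?_
  push_cast
  generalize hW : x₁ s * y₂ s - y₁ s * x₂ s = W at *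
  field_simp
  rw [← hW]
  ring

/-- Lagrange–Jacobi: since the potential has degree `-2`, Euler's identity makes the derivative of
the radial product `2K + 2V = 2H`, which is zero by conservation of energy. -/
theorem radial_eq_zero (h : IsJacobiSolution κ T x₁ y₁ x₂ y₂ u₁ v₁ u₂ v₂) (hT : T.OrdConnected)
    {t₀ t : ℝ} (ht₀ : t₀ ∈ T) (ht : t ∈ T)
    (h0 : (u₁ t₀ ^ 2 + v₁ t₀ ^ 2 + u₂ t₀ ^ 2 + v₂ t₀ ^ 2) / 2 -
      κ * (x₁ t₀ ^ 2 + y₁ t₀ ^ 2 + x₂ t₀ ^ 2 + y₂ t₀ ^ 2) /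
        (x₁ t₀ * y₂ t₀ - y₁ t₀ * x₂ t₀) ^ 2 = 0)
    (hr : x₁ t₀ * u₁ t₀ + y₁ t₀ * v₁ t₀ + x₂ t₀ * u₂ t₀ + y₂ t₀ * v₂ t₀ = 0) :
    x₁ t * u₁ t + y₁ t * v₁ t + x₂ t * u₂ t + y₂ t * v₂ t = 0 := by
  rw [← hr]
  refine eq_of_hasDerivAt_zero hT
    (f := fun t => x₁ t * u₁ t + y₁ t * v₁ t + x₂ t * u₂ t + y₂ t * v₂ t) (fun s hs => ?_) ht ht₀
  have hw := h.wedge_ne_zero s hs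
  have hE := h.energy_eq_zero hT ht₀ hs h0
  refine HasDerivAt.congr_deriv (((((h.x₁' s hs).fun_mul (h.u₁' s hs)).fun_add ((h.y₁' s
      hs).fun_mul (h.v₁' s hs))).fun_add
    ((h.x₂' s hs).fun_mul (h.u₂' s hs))).fun_add ((h.y₂' s hs).fun_mul (h.v₂' s hs))) ?_
  generalize hW : x₁ s * y₂ s - y₁ s * x₂ s = W at *
  field_simp at hE ⊢
  linear_combination W * hE - 4 * κ * (x₁ s ^ 2 + y₁ s ^ 2 + x₂ s ^ 2 + y₂ s ^ 2) * hW

theorem inertia_eq (h : IsJacobiSolution κ T x₁ y₁ x₂ y₂ u₁ v₁ u₂ v₂) (hT : T.OrdConnected)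
    {t₀ t : ℝ} (ht₀ : t₀ ∈ T) (ht : t ∈ T)
    (h0 : (u₁ t₀ ^ 2 + v₁ t₀ ^ 2 + u₂ t₀ ^ 2 + v₂ t₀ ^ 2) / 2 -
      κ * (x₁ t₀ ^ 2 + y₁ t₀ ^ 2 + x₂ t₀ ^ 2 + y₂ t₀ ^ 2) /
        (x₁ t₀ * y₂ t₀ - y₁ t₀ * x₂ t₀) ^ 2 = 0)
    (hr : x₁ t₀ * u₁ t₀ + y₁ t₀ * v₁ t₀ + x₂ t₀ * u₂ t₀ + y₂ t₀ * v₂ t₀ = 0) :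
    x₁ t ^ 2 + y₁ t ^ 2 + x₂ t ^ 2 + y₂ t ^ 2 =
      x₁ t₀ ^ 2 + y₁ t₀ ^ 2 + x₂ t₀ ^ 2 + y₂ t₀ ^ 2 := by
  refine eq_of_hasDerivAt_zero hT (f := fun t => x₁ t ^ 2 + y₁ t ^ 2 + x₂ t ^ 2 + y₂ t ^ 2)
    (fun s hs => ?_) ht ht₀
  have hr' := h.radial_eq_zero hT ht₀ hs h0 hr
  refine HasDerivAt.congr_deriv (((((h.x₁' s hs).fun_pow 2).fun_add ((h.y₁' s hs).fun_pow
      2)).fun_add ((h.x₂' s hs).fun_pow 2)).fun_add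
    ((h.y₂' s hs).fun_pow 2)) ?_
  push_cast
  linear_combination 2 * hr'

theorem angular_eq_zero (h : IsJacobiSolution κ T x₁ y₁ x₂ y₂ u₁ v₁ u₂ v₂) (hT : T.OrdConnected)
    {t₀ t : ℝ} (ht₀ : t₀ ∈ T) (ht : t ∈ T)
    (hj : x₁ t₀ * v₁ t₀ - y₁ t₀ * u₁ t₀ + (x₂ t₀ * v₂ t₀ - y₂ t₀ * u₂ t₀) = 0) :
    x₁ t * v₁ t - y₁ t * u₁ t + (x₂ t * v₂ t - y₂ t * u₂ t) = 0 := by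
  rw [← hj]
  refine eq_of_hasDerivAt_zero hT
    (f := fun t => x₁ t * v₁ t - y₁ t * u₁ t + (x₂ t * v₂ t - y₂ t * u₂ t)) (fun s hs => ?_) ht ht₀
  refine HasDerivAt.congr_deriv ((((h.x₁' s hs).fun_mul (h.v₁' s hs)).fun_sub ((h.y₁' s
      hs).fun_mul (h.u₁' s hs))).fun_add
    (((h.x₂' s hs).fun_mul (h.v₂' s hs)).fun_sub ((h.y₂' s hs).fun_mul (h.u₂' s hs)))) ?_
  ring

/-- For vanishing energy, angular momentum and radial velocity, the first two Hopf coordinates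
are affine functions of time, and not both are constant. -/
theorem hopf_affine (h : IsJacobiSolution κ T x₁ y₁ x₂ y₂ u₁ v₁ u₂ v₂) (hT : T.OrdConnected)
    (hκ : 0 < κ) {t₀ : ℝ} (ht₀ : t₀ ∈ T)
    (h0 : (u₁ t₀ ^ 2 + v₁ t₀ ^ 2 + u₂ t₀ ^ 2 + v₂ t₀ ^ 2) / 2 -
      κ * (x₁ t₀ ^ 2 + y₁ t₀ ^ 2 + x₂ t₀ ^ 2 + y₂ t₀ ^ 2) /
        (x₁ t₀ * y₂ t₀ - y₁ t₀ * x₂ t₀) ^ 2 = 0)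
    (hr : x₁ t₀ * u₁ t₀ + y₁ t₀ * v₁ t₀ + x₂ t₀ * u₂ t₀ + y₂ t₀ * v₂ t₀ = 0)
    (hj : x₁ t₀ * v₁ t₀ - y₁ t₀ * u₁ t₀ + (x₂ t₀ * v₂ t₀ - y₂ t₀ * u₂ t₀) = 0) :
    ∃ a₁ b₁ a₂ b₂ : ℝ, (b₁ ≠ 0 ∨ b₂ ≠ 0) ∧ ∀ t ∈ T,
      (x₁ t ^ 2 + y₁ t ^ 2 - (x₂ t ^ 2 + y₂ t ^ 2)) / 2 = a₁ + b₁ * t ∧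
      x₁ t * x₂ t + y₁ t * y₂ t = a₂ + b₂ * t := by
  have hd₁ : ∀ t ∈ T, HasDerivAt (fun t => (x₁ t ^ 2 + y₁ t ^ 2 - (x₂ t ^ 2 + y₂ t ^ 2)) / 2)
      (x₁ t * u₁ t + y₁ t * v₁ t - (x₂ t * u₂ t + y₂ t * v₂ t)) t := fun t ht => by
    refine HasDerivAt.congr_deriv (((((h.x₁' t ht).fun_pow 2).fun_add ((h.y₁' t ht).fun_pow 2)).sub
      (((h.x₂' t ht).fun_pow 2).fun_add ((h.y₂' t ht).fun_pow 2))).div_const 2) ?_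
    push_cast
    ring
  have hd₂ : ∀ t ∈ T, HasDerivAt (fun t => x₁ t * x₂ t + y₁ t * y₂ t)
      (u₁ t * x₂ t + x₁ t * u₂ t + (v₁ t * y₂ t + y₁ t * v₂ t)) t := fun t ht =>
    ((h.x₁' t ht).fun_mul (h.x₂' t ht)).fun_add ((h.y₁' t ht).fun_mul (h.y₂' t ht))
  have hI : ∀ t ∈ T, x₁ t ^ 2 + y₁ t ^ 2 + x₂ t ^ 2 + y₂ t ^ 2 ≠ 0 := fun t ht h0 => by
    have e₁ : x₁ t = 0 := by
      nlinarith [sq_nonneg (x₁ t), sq_nonneg (y₁ t), sq_nonneg (x₂ t), sq_nonneg (y₂ t)]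
    have e₂ : y₁ t = 0 := by
      nlinarith [sq_nonneg (x₁ t), sq_nonneg (y₁ t), sq_nonneg (x₂ t), sq_nonneg (y₂ t)]
    exact h.wedge_ne_zero t ht (by simp [e₁, e₂])
  -- `hR` and `hJ` are the real and imaginary parts of `Z̄₁Ż₁ + Z̄₂Ż₂ = 0`. They give `I(|Ż₁|² -
  -- |Ż₂|²) = -2w₁|Ż|²`, and zero energy gives `|Ż|² = 2κI/w₃²`; this cancels the force term
  -- `4κw₁/w₃²`. Multiplying by `I` keeps the identity polynomial. The argument for `w₂` is the
  -- same.
  have hdd₁ : ∀ t ∈ T, HasDerivAt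
      (fun t => x₁ t * u₁ t + y₁ t * v₁ t - (x₂ t * u₂ t + y₂ t * v₂ t)) 0 t := fun t ht => by
    have hw := h.wedge_ne_zero t ht
    have hE := h.energy_eq_zero hT ht₀ ht h0
    have hR := h.radial_eq_zero hT ht₀ ht h0 hr
    have hJ := h.angular_eq_zero hT ht₀ ht hj
    refine HasDerivAt.congr_deriv ((((h.x₁' t ht).fun_mul (h.u₁' t ht)).fun_add ((h.y₁' t
        ht).fun_mul (h.v₁' t ht))).sub
      (((h.x₂' t ht).fun_mul (h.u₂' t ht)).fun_add ((h.y₂' t ht).fun_mul (h.v₂' t ht)))) ?_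
    refine mul_left_cancel₀ (hI t ht) ?_
    generalize hW : x₁ t * y₂ t - y₁ t * x₂ t = W at *
    field_simp at hE ⊢
    linear_combination 2 * W ^ 3 *
      ((x₁ t * u₁ t + y₁ t * v₁ t - (x₂ t * u₂ t + y₂ t * v₂ t)) * hR +
        (x₁ t * v₁ t - y₁ t * u₁ t - (x₂ t * v₂ t - y₂ t * u₂ t)) * hJ) -
      W * (x₁ t ^ 2 + y₁ t ^ 2 - (x₂ t ^ 2 + y₂ t ^ 2)) * hE
  have hdd₂ : ∀ t ∈ T, HasDerivAt
      (fun t => u₁ t * x₂ t + x₁ t * u₂ t + (v₁ t * y₂ t + y₁ t * v₂ t)) 0 t := fun t ht => by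
    have hw := h.wedge_ne_zero t ht
    have hE := h.energy_eq_zero hT ht₀ ht h0
    have hR := h.radial_eq_zero hT ht₀ ht h0 hr
    have hJ := h.angular_eq_zero hT ht₀ ht hj
    refine HasDerivAt.congr_deriv ((((h.u₁' t ht).fun_mul (h.x₂' t ht)).fun_add
      ((h.x₁' t ht).fun_mul (h.u₂' t ht))).fun_add (((h.v₁' t ht).fun_mul (h.y₂' t ht)).fun_add
      ((h.y₁' t ht).fun_mul (h.v₂' t ht)))) ?_
    refine mul_left_cancel₀ (hI t ht) ?_
    generalize hW : x₁ t * y₂ t - y₁ t * x₂ t = W at *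
    field_simp at hE ⊢
    linear_combination 2 * W ^ 3 *
      ((x₁ t * u₂ t + y₁ t * v₂ t + (x₂ t * u₁ t + y₂ t * v₁ t)) * hR +
        (x₁ t * v₂ t - y₁ t * u₂ t - (u₁ t * y₂ t - v₁ t * x₂ t)) * hJ) -
      2 * W * (x₁ t * x₂ t + y₁ t * y₂ t) * hE
  set b₁ := x₁ t₀ * u₁ t₀ + y₁ t₀ * v₁ t₀ - (x₂ t₀ * u₂ t₀ + y₂ t₀ * v₂ t₀) with hb₁
  set b₂ := u₁ t₀ * x₂ t₀ + x₁ t₀ * u₂ t₀ + (v₁ t₀ * y₂ t₀ + y₁ t₀ * v₂ t₀) with hb₂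
  refine ⟨(x₁ t₀ ^ 2 + y₁ t₀ ^ 2 - (x₂ t₀ ^ 2 + y₂ t₀ ^ 2)) / 2 - b₁ * t₀, b₁,
    x₁ t₀ * x₂ t₀ + y₁ t₀ * y₂ t₀ - b₂ * t₀, b₂, ?_, fun t ht => ⟨?_, ?_⟩⟩
  -- If `ẇ₁ = ẇ₂ = 0`, then differentiating `|w|² = I²/4` gives `ẇ₃ = 0`. The identity `I|Ż|² = |ẇ|²
  -- + J²` then forces `Ż = 0`, so the energy would be the nonzero potential.
  · by_contra! hb
    have hw := h.wedge_ne_zero t₀ ht₀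
    set w := x₁ t₀ * y₂ t₀ - y₁ t₀ * x₂ t₀ with hwdef
    set w' := u₁ t₀ * y₂ t₀ + x₁ t₀ * v₂ t₀ - (v₁ t₀ * x₂ t₀ + y₁ t₀ * u₂ t₀) with hw'
    have e₁ : w * w' = 0 := by
      linear_combination (x₁ t₀ ^ 2 + y₁ t₀ ^ 2 + x₂ t₀ ^ 2 + y₂ t₀ ^ 2) / 2 * hr -
        (x₁ t₀ ^ 2 + y₁ t₀ ^ 2 - (x₂ t₀ ^ 2 + y₂ t₀ ^ 2)) / 2 * hb.1 -
        (x₁ t₀ * x₂ t₀ + y₁ t₀ * y₂ t₀) * hb.2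
    have e₂ : w' = 0 := (mul_eq_zero.1 e₁).resolve_left hw
    have e₃ : (x₁ t₀ ^ 2 + y₁ t₀ ^ 2 + x₂ t₀ ^ 2 + y₂ t₀ ^ 2) *
        (u₁ t₀ ^ 2 + v₁ t₀ ^ 2 + u₂ t₀ ^ 2 + v₂ t₀ ^ 2) = 0 := by
      linear_combination b₁ * hb.1 + b₂ * hb.2 + w' * e₂ +
        (x₁ t₀ * v₁ t₀ - y₁ t₀ * u₁ t₀ + (x₂ t₀ * v₂ t₀ - y₂ t₀ * u₂ t₀)) * hj
    rw [(mul_eq_zero.1 e₃).resolve_left (hI t₀ ht₀)] at h0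
    have : κ * (x₁ t₀ ^ 2 + y₁ t₀ ^ 2 + x₂ t₀ ^ 2 + y₂ t₀ ^ 2) / w ^ 2 ≠ 0 := by
      have := hI t₀ ht₀
      positivity
    apply this
    linarith
  · have := eq_affine_of_hasDerivAt hT hd₁ hdd₁ ht₀ ht
    linarith
  · have := eq_affine_of_hasDerivAt hT hd₂ hdd₂ ht₀ ht
    linarith

end IsJacobiSolution
end ThreeBody
end

/-! ### Forces, energy and momenta in Jacobi vectors -/

noncomputable section
namespace ThreeBody
open Complex

/-- The acceleration `-m_a⁻¹ ∇_a V` of body `a`. -/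
def acceleration (m : Fin 3 → ℝ) (γ : ℝ) (q : Config) : Config := fun a =>
  ((2 * γ / ((m 0 + m 1 + m 2) * signedArea q ^ 2) : ℝ) : ℂ) *
      ((m (a + 1) : ℂ) * (q a - q (a + 1)) + (m (a + 2) : ℂ) * (q a - q (a + 2))) +
    ((γ * momentOfInertia m q / (m a * signedArea q ^ 3) : ℝ) : ℂ) *
      (I * (q (a + 1) - q (a + 2)))

theorem momentOfInertia_update (m : Fin 3 → ℝ) (q : Config) (a : Fin 3) (z : ℂ) :
    momentOfInertia m (Function.update q a z) =
      (m a * m (a + 1) * ((z.re - (q (a + 1)).re) ^ 2 + (z.im - (q (a + 1)).im) ^ 2) +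
        m a * m (a + 2) * ((z.re - (q (a + 2)).re) ^ 2 + (z.im - (q (a + 2)).im) ^ 2) +
        m (a + 1) * m (a + 2) * ‖q (a + 1) - q (a + 2)‖ ^ 2) / (m 0 + m 1 + m 2) := by
  fin_cases a <;> simp [momentOfInertia, Function.update, Complex.sq_norm, normSq_apply] <;> ring

/-- The indices `a + 1`, `a + 2` are cyclic in `Fin 3`, and cyclic relabelling preserves
orientation, so one formula, affine in the moving vertex, serves all three bodies. -/
theorem signedArea_update (q : Config) (a : Fin 3) (z : ℂ) :
    signedArea (Function.update q a z) =
      (z.re * ((q (a + 1)).im - (q (a + 2)).im) - z.im * ((q (a + 1)).re - (q (a + 2)).re) +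
        wedge (q (a + 1)) (q (a + 2))) / 2 := by
  fin_cases a <;> simp [signedArea, wedge, Function.update] <;> ring

theorem gradPotential_eq {m : Fin 3 → ℝ} (hm : ∀ a, 0 < m a) (γ : ℝ) {q : Config}
    (hq : signedArea q ≠ 0) (a : Fin 3) :
    gradPotential m γ q a = -((m a : ℂ) * acceleration m γ q a) := by
  have hM : m 0 + m 1 + m 2 ≠ 0 := by linarith [hm 0, hm 1, hm 2]
  have hma := (hm a).ne'
  refine HasGradientAt.gradient (hasGradientAt_iff_hasFDerivAt.2 ?_)
  have hre := reCLM.hasFDerivAt (x := q a)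
  have him := imCLM.hasFDerivAt (x := q a)
  have hi := (((((hre.sub_const (q (a + 1)).re).pow 2).add
    ((him.sub_const (q (a + 1)).im).pow 2)).const_mul (m a * m (a + 1))).add
    ((((hre.sub_const (q (a + 2)).re).pow 2).add
    ((him.sub_const (q (a + 2)).im).pow 2)).const_mul (m a * m (a + 2)))).add_const
    (m (a + 1) * m (a + 2) * ‖q (a + 1) - q (a + 2)‖ ^ 2)
  have hi' := hi.mul_const (m 0 + m 1 + m 2)⁻¹
  have hd := (((hre.mul_const ((q (a + 1)).im - (q (a + 2)).im)).sub
    (him.mul_const ((q (a + 1)).re - (q (a + 2)).re))).add_const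
    (wedge (q (a + 1)) (q (a + 2)))).mul_const (2 : ℝ)⁻¹
  have hi₀ := momentOfInertia_update m q a (q a)
  have hd₀ := signedArea_update q a (q a)
  rw [Function.update_eq_self] at hi₀ hd₀
  have hD : ((q a).re * ((q (a + 1)).im - (q (a + 2)).im) -
      (q a).im * ((q (a + 1)).re - (q (a + 2)).re) +
        wedge (q (a + 1)) (q (a + 2))) * (2 : ℝ)⁻¹ = signedArea q := by rw [hd₀]; rfl
  have hV := (hi'.const_mul γ).neg.mul ((hasDerivAt_inv (pow_ne_zero 2 hq)).comp_hasFDerivAt_of_eq _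
    (hd.pow 2) (by rw [← hD]; rfl))
  refine (hV.congr_of_eventuallyEq (.of_forall fun z => ?_)).congr_fderiv ?_
  · rw [potential, momentOfInertia_update, signedArea_update]
    simp
    ring
  · refine ContinuousLinearMap.ext fun v => ?_
    rw [InnerProductSpace.toDual_apply_apply, Complex.inner]
    simp only [add_apply, smul_apply,
      sub_apply, neg_apply, Pi.sub_apply, Pi.add_apply,
      Pi.neg_apply, Function.comp_apply, reCLM_apply, imCLM_apply, hD, smul_eq_mul, nsmul_eq_mul,
      acceleration, hi₀, mul_re, mul_im, neg_re, neg_im, conj_re, conj_im, add_re, add_im,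
      sub_re, sub_im, ofReal_re, ofReal_im, I_re, I_im]
    field_simp
    ring

theorem accel_of_newton {m : Fin 3 → ℝ} (hm : ∀ a, 0 < m a) (γ : ℝ) {q : Config}
    (hq : signedArea q ≠ 0) (a : Fin 3) (z : ℂ) :
    (m a : ℂ) * z = -gradPotential m γ q a ↔ z = acceleration m γ q a := by
  rw [gradPotential_eq hm γ hq, neg_neg, mul_right_inj' (by exact_mod_cast (hm a).ne')]

theorem scale₁_sq {m : Fin 3 → ℝ} (hm : ∀ a, 0 < m a) :
    √(m 0 * m 1 / (m 0 + m 1)) ^ 2 * (m 0 + m 1) = m 0 * m 1 := by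
  have := hm 0; have := hm 1
  rw [Real.sq_sqrt (by positivity)]
  field_simp

theorem scale₂_sq {m : Fin 3 → ℝ} (hm : ∀ a, 0 < m a) :
    √(m 2 * (m 0 + m 1) / (m 0 + m 1 + m 2)) ^ 2 * (m 0 + m 1 + m 2) = m 2 * (m 0 + m 1) := by
  have := hm 0; have := hm 1; have := hm 2
  rw [Real.sq_sqrt (by positivity)]
  field_simp

theorem scale₁_pos {m : Fin 3 → ℝ} (hm : ∀ a, 0 < m a) : 0 < √(m 0 * m 1 / (m 0 + m 1)) := by
  have := hm 0; have := hm 1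
  positivity

theorem scale₂_pos {m : Fin 3 → ℝ} (hm : ∀ a, 0 < m a) :
    0 < √(m 2 * (m 0 + m 1) / (m 0 + m 1 + m 2)) := by
  have := hm 0; have := hm 1; have := hm 2
  positivity

theorem jacobi₁_re (m : Fin 3 → ℝ) (q : Config) :
    (jacobi₁ m q).re = √(m 0 * m 1 / (m 0 + m 1)) * ((q 1).re - (q 0).re) := by
  simp [jacobi₁]

theorem jacobi₁_im (m : Fin 3 → ℝ) (q : Config) :
    (jacobi₁ m q).im = √(m 0 * m 1 / (m 0 + m 1)) * ((q 1).im - (q 0).im) := by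
  simp [jacobi₁]

theorem jacobi₂_re (m : Fin 3 → ℝ) (q : Config) :
    (jacobi₂ m q).re = √(m 2 * (m 0 + m 1) / (m 0 + m 1 + m 2)) *
      ((q 2).re - (m 0 * (q 0).re + m 1 * (q 1).re) / (m 0 + m 1)) := by
  rw [jacobi₂, ← ofReal_add, re_ofReal_mul, sub_re, div_ofReal_re]
  simp

theorem jacobi₂_im (m : Fin 3 → ℝ) (q : Config) :
    (jacobi₂ m q).im = √(m 2 * (m 0 + m 1) / (m 0 + m 1 + m 2)) *
      ((q 2).im - (m 0 * (q 0).im + m 1 * (q 1).im) / (m 0 + m 1)) := by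
  rw [jacobi₂, ← ofReal_add, im_ofReal_mul, sub_im, div_ofReal_im]
  simp

theorem wedge_jacobi (m : Fin 3 → ℝ) (hm : ∀ a, 0 < m a) (q : Config) :
    (jacobi₁ m q).re * (jacobi₂ m q).im - (jacobi₁ m q).im * (jacobi₂ m q).re =
      2 * √(m 0 * m 1 / (m 0 + m 1)) * √(m 2 * (m 0 + m 1) / (m 0 + m 1 + m 2)) *
        signedArea q := by
  have := hm 0; have := hm 1
  rw [jacobi₁_re, jacobi₁_im, jacobi₂_re, jacobi₂_im, signedArea, wedge]
  simp only [sub_re, sub_im]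
  field_simp
  ring

theorem momentOfInertia_eq {m : Fin 3 → ℝ} (hm : ∀ a, 0 < m a) (q : Config) :
    momentOfInertia m q = (jacobi₁ m q).re ^ 2 + (jacobi₁ m q).im ^ 2 + (jacobi₂ m q).re ^ 2 +
      (jacobi₂ m q).im ^ 2 := by
  have := hm 0; have := hm 1; have := hm 2
  rw [jacobi₁_re, jacobi₁_im, jacobi₂_re, jacobi₂_im, momentOfInertia]
  simp only [mul_pow, Complex.sq_norm, normSq_apply, sub_re, sub_im]
  rw [eq_div_of_mul_eq (by positivity) (scale₁_sq hm), eq_div_of_mul_eq (by positivity)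
    (scale₂_sq hm)]
  field_simp
  ring

theorem kineticEnergy_eq {m : Fin 3 → ℝ} (hm : ∀ a, 0 < m a) (v : Config)
    (hv : linearMomentum m v = 0) :
    kineticEnergy m v = ((jacobi₁ m v).re ^ 2 + (jacobi₁ m v).im ^ 2 + (jacobi₂ m v).re ^ 2 +
      (jacobi₂ m v).im ^ 2) / 2 := by
  have := hm 0; have := hm 1; have := hm 2
  have h1 := congrArg re hv
  have h2 := congrArg im hv
  simp only [linearMomentum, Fin.sum_univ_three, add_re, add_im, re_ofReal_mul, im_ofReal_mul,
    zero_re, zero_im] at h1 h2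
  rw [jacobi₁_re, jacobi₁_im, jacobi₂_re, jacobi₂_im, kineticEnergy, Fin.sum_univ_three]
  simp only [mul_pow, Complex.sq_norm, normSq_apply]
  rw [eq_div_of_mul_eq (by positivity) (scale₁_sq hm), eq_div_of_mul_eq (by positivity)
    (scale₂_sq hm)]
  field_simp
  linear_combination (m 0 + m 1) * (m 0 * (v 0).re + m 1 * (v 1).re + m 2 * (v 2).re) * h1 +
    (m 0 + m 1) * (m 0 * (v 0).im + m 1 * (v 1).im + m 2 * (v 2).im) * h2

/-- The center of mass contributes its position wedge the total momentum, so only the momentum has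
to vanish; the configuration need not be centered. -/
theorem angularMomentum_eq {m : Fin 3 → ℝ} (hm : ∀ a, 0 < m a) (q v : Config)
    (hv : linearMomentum m v = 0) :
    angularMomentum m q v = (jacobi₁ m q).re * (jacobi₁ m v).im -
      (jacobi₁ m q).im * (jacobi₁ m v).re + ((jacobi₂ m q).re * (jacobi₂ m v).im -
      (jacobi₂ m q).im * (jacobi₂ m v).re) := by
  have := hm 0; have := hm 1; have := hm 2
  have h1 := congrArg re hv
  have h2 := congrArg im hv
  simp only [linearMomentum, Fin.sum_univ_three, add_re, add_im, re_ofReal_mul, im_ofReal_mul,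
    zero_re, zero_im] at h1 h2
  have e1 := scale₁_sq hm
  have e2 := scale₂_sq hm
  simp only [jacobi₁_re, jacobi₁_im, jacobi₂_re, jacobi₂_im]
  rw [angularMomentum, Fin.sum_univ_three]
  simp only [wedge]
  generalize √(m 0 * m 1 / (m 0 + m 1)) = s₁ at *
  generalize √(m 2 * (m 0 + m 1) / (m 0 + m 1 + m 2)) = s₂ at *
  have e1' := eq_div_of_mul_eq (by positivity) e1
  have e2' := eq_div_of_mul_eq (by positivity) e2
  -- Collecting the scale factors into squares lets `e1'` and `e2'` replace the square roots by
  -- rational functions of the masses.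
  trans s₁ ^ 2 * wedge (q 1 - q 0) (v 1 - v 0) + s₂ ^ 2 *
    wedge (q 2 - ((m 0 : ℂ) * q 0 + m 1 * q 1) / ((m 0 + m 1 : ℝ) : ℂ))
      (v 2 - ((m 0 : ℂ) * v 0 + m 1 * v 1) / ((m 0 + m 1 : ℝ) : ℂ))
  · rw [e1', e2']
    simp only [wedge, sub_re, sub_im, div_ofReal_re, div_ofReal_im, add_re, add_im,
      re_ofReal_mul, im_ofReal_mul]
    field_simp
    linear_combination (m 0 + m 1) *
      ((m 0 * (q 0).re + m 1 * (q 1).re + m 2 * (q 2).re) * h2 -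
        (m 0 * (q 0).im + m 1 * (q 1).im + m 2 * (q 2).im) * h1)
  · simp only [wedge, sub_re, sub_im, div_ofReal_re, div_ofReal_im, add_re, add_im,
      re_ofReal_mul, im_ofReal_mul]
    ring

/-- Modulo translations the mass metric is Euclidean in the Jacobi vectors, so the acceleration is
minus the Euclidean gradient of `-κI/W²`. The gradient of `W = Z₁ ∧ Z₂` in `Z₁` is `-iZ₂`, and in
`Z₂` it is `iZ₁`, which explains the opposite signs here and in `jacobi₂_acceleration`. -/
theorem jacobi₁_acceleration {m : Fin 3 → ℝ} (hm : ∀ a, 0 < m a) (γ : ℝ) {q : Config}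
    {κ W i : ℝ} (hκ : κ = 4 * γ * √(m 0 * m 1 / (m 0 + m 1)) ^ 2 *
      √(m 2 * (m 0 + m 1) / (m 0 + m 1 + m 2)) ^ 2)
    (hW : W = 2 * √(m 0 * m 1 / (m 0 + m 1)) * √(m 2 * (m 0 + m 1) / (m 0 + m 1 + m 2)) *
        signedArea q) (hi : momentOfInertia m q = i) (hq : signedArea q ≠ 0) :
    jacobi₁ m (acceleration m γ q) = ((2 * κ / W ^ 2 : ℝ) : ℂ) * jacobi₁ m q +
      ((2 * κ * i / W ^ 3 : ℝ) : ℂ) * (I * jacobi₂ m q) := by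
  have hs₁ := scale₁_pos hm
  have hs₂ := scale₂_pos hm
  have e1 := scale₁_sq hm
  have e2 := scale₂_sq hm
  have := hm 0; have := hm 1; have := hm 2
  simp only [acceleration, jacobi₁, jacobi₂, hκ, hW, hi]
  generalize √(m 0 * m 1 / (m 0 + m 1)) = s₁ at *
  generalize √(m 2 * (m 0 + m 1) / (m 0 + m 1 + m 2)) = s₂ at *
  generalize signedArea q = D at *
  have e1' : (s₁ : ℂ) ^ 2 * (m 0 + m 1) = m 0 * m 1 := by exact_mod_cast e1
  have e2' : (s₂ : ℂ) ^ 2 * (m 0 + m 1 + m 2) = m 2 * (m 0 + m 1) := by exact_mod_cast e2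
  have h0 : (m 0 : ℂ) ≠ 0 := by exact_mod_cast (hm 0).ne'
  have h1 : (m 1 : ℂ) ≠ 0 := by exact_mod_cast (hm 1).ne'
  have h2 : (m 2 : ℂ) ≠ 0 := by exact_mod_cast (hm 2).ne'
  have h01 : (m 0 + m 1 : ℂ) ≠ 0 := by exact_mod_cast (add_pos (hm 0) (hm 1)).ne'
  have h012 : (m 0 + m 1 + m 2 : ℂ) ≠ 0 := by
    exact_mod_cast (add_pos (add_pos (hm 0) (hm 1)) (hm 2)).ne'
  have hs₁' : (s₁ : ℂ) ≠ 0 := by exact_mod_cast hs₁.ne'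
  have hs₂' : (s₂ : ℂ) ≠ 0 := by exact_mod_cast hs₂.ne'
  have hD : (D : ℂ) ≠ 0 := by exact_mod_cast hq
  simp only [show (0 + 1 : Fin 3) = 1 from rfl, show (0 + 2 : Fin 3) = 2 from rfl,
    show (1 + 1 : Fin 3) = 2 from rfl, show (1 + 2 : Fin 3) = 0 from rfl]
  push_cast
  field_simp
  linear_combination 4 * γ * i * I * (m 0 + m 1 + m 2) *
    ((m 0 + m 1) * q 2 - m 0 * q 0 - m 1 * q 1) * e1'

theorem jacobi₂_acceleration {m : Fin 3 → ℝ} (hm : ∀ a, 0 < m a) (γ : ℝ) {q : Config}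
    {κ W i : ℝ} (hκ : κ = 4 * γ * √(m 0 * m 1 / (m 0 + m 1)) ^ 2 *
      √(m 2 * (m 0 + m 1) / (m 0 + m 1 + m 2)) ^ 2)
    (hW : W = 2 * √(m 0 * m 1 / (m 0 + m 1)) * √(m 2 * (m 0 + m 1) / (m 0 + m 1 + m 2)) *
        signedArea q) (hi : momentOfInertia m q = i) (hq : signedArea q ≠ 0) :
    jacobi₂ m (acceleration m γ q) = ((2 * κ / W ^ 2 : ℝ) : ℂ) * jacobi₂ m q -
      ((2 * κ * i / W ^ 3 : ℝ) : ℂ) * (I * jacobi₁ m q) := by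
  have hs₁ := scale₁_pos hm
  have hs₂ := scale₂_pos hm
  have e1 := scale₁_sq hm
  have e2 := scale₂_sq hm
  have := hm 0; have := hm 1; have := hm 2
  simp only [acceleration, jacobi₁, jacobi₂, hκ, hW, hi]
  generalize √(m 0 * m 1 / (m 0 + m 1)) = s₁ at *
  generalize √(m 2 * (m 0 + m 1) / (m 0 + m 1 + m 2)) = s₂ at *
  generalize signedArea q = D at *
  have e1' : (s₁ : ℂ) ^ 2 * (m 0 + m 1) = m 0 * m 1 := by exact_mod_cast e1
  have e2' : (s₂ : ℂ) ^ 2 * (m 0 + m 1 + m 2) = m 2 * (m 0 + m 1) := by exact_mod_cast e2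
  have h0 : (m 0 : ℂ) ≠ 0 := by exact_mod_cast (hm 0).ne'
  have h1 : (m 1 : ℂ) ≠ 0 := by exact_mod_cast (hm 1).ne'
  have h2 : (m 2 : ℂ) ≠ 0 := by exact_mod_cast (hm 2).ne'
  have h01 : (m 0 + m 1 : ℂ) ≠ 0 := by exact_mod_cast (add_pos (hm 0) (hm 1)).ne'
  have h012 : (m 0 + m 1 + m 2 : ℂ) ≠ 0 := by
    exact_mod_cast (add_pos (add_pos (hm 0) (hm 1)) (hm 2)).ne'
  have hs₁' : (s₁ : ℂ) ≠ 0 := by exact_mod_cast hs₁.ne'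
  have hs₂' : (s₂ : ℂ) ≠ 0 := by exact_mod_cast hs₂.ne'
  have hD : (D : ℂ) ≠ 0 := by exact_mod_cast hq
  simp only [show (0 + 1 : Fin 3) = 1 from rfl, show (0 + 2 : Fin 3) = 2 from rfl,
    show (1 + 1 : Fin 3) = 2 from rfl, show (1 + 2 : Fin 3) = 0 from rfl,
    show (2 + 1 : Fin 3) = 0 from rfl, show (2 + 2 : Fin 3) = 1 from rfl]
  push_cast
  field_simp
  linear_combination 4 * γ * i * I * (m 0 + m 1 + m 2) * (q 0 - q 1) * e2'

end ThreeBody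
end

/-! ### Busemann functions as calibrations of hyperbolic length -/

noncomputable section
namespace ThreeBody
open Set

/-- The function `log (|w - p|² / |w₃|)` with `p = (x, y, 0)`: a Busemann function of the metric
`|dw|² / w₃²` centered at the ideal point `p`. -/
def busemann (x y : ℝ) (w : ShapeSpace) : ℝ :=
  Real.log ((w 0 - x) ^ 2 + (w 1 - y) ^ 2 + w 2 ^ 2) - Real.log (w 2)

/-- The differential of `busemann x y` at `w` in the direction `d`. -/
def busemannDeriv (x y : ℝ) (w d : ShapeSpace) : ℝ :=
  (2 * (w 0 - x) * d 0 + 2 * (w 1 - y) * d 1 + 2 * w 2 * d 2) /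
    ((w 0 - x) ^ 2 + (w 1 - y) ^ 2 + w 2 ^ 2) - d 2 / w 2

theorem norm_shapeSpace_sq (d : ShapeSpace) : ‖d‖ ^ 2 = d 0 ^ 2 + d 1 ^ 2 + d 2 ^ 2 := by
  rw [EuclideanSpace.norm_sq_eq, Fin.sum_univ_three]
  simp

/-- A Busemann function is 1-Lipschitz for the hyperbolic metric. The defect between the two squares
is written as a sum of squares, as in Lagrange's identity. Only `w₃ ≠ 0` matters, because `Real.log`
is even, so both half-spaces are covered. -/
theorem busemannDeriv_le (x y : ℝ) {w : ShapeSpace} (hw : w 2 ≠ 0) (d : ShapeSpace) :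
    busemannDeriv x y w d ≤ ‖d‖ / |w 2| := by
  refine le_of_sq_le_sq ?_ (by positivity)
  rw [div_pow, norm_shapeSpace_sq, sq_abs, busemannDeriv]
  generalize w 0 - x = a
  generalize w 1 - y = b
  have hρ : 0 < a ^ 2 + b ^ 2 + w 2 ^ 2 := by positivity
  have key : (d 0 ^ 2 + d 1 ^ 2 + d 2 ^ 2) / w 2 ^ 2 -
      ((2 * a * d 0 + 2 * b * d 1 + 2 * w 2 * d 2) / (a ^ 2 + b ^ 2 + w 2 ^ 2) - d 2 / w 2) ^ 2 =
      ((2 * a * w 2 * d 1 - 2 * b * w 2 * d 0) ^ 2 +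
        (2 * a * w 2 * d 2 - (w 2 ^ 2 - a ^ 2 - b ^ 2) * d 0) ^ 2 +
        (2 * b * w 2 * d 2 - (w 2 ^ 2 - a ^ 2 - b ^ 2) * d 1) ^ 2) /
        ((a ^ 2 + b ^ 2 + w 2 ^ 2) * w 2) ^ 2 := by
    field_simp
    ring
  rw [← sub_nonneg, key]
  positivity

theorem hasDerivAt_apply {c : ℝ → ShapeSpace} {d : ShapeSpace} {t : ℝ} (h : HasDerivAt c d t)
    (i : Fin 3) : HasDerivAt (fun s => c s i) (d i) t :=
  (EuclideanSpace.proj (𝕜 := ℝ) i).hasFDerivAt.comp_hasDerivAt t h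

theorem hasDerivAt_busemann (x y : ℝ) {c : ℝ → ShapeSpace} {d : ShapeSpace} {t : ℝ}
    (h : HasDerivAt c d t) (hc : c t 2 ≠ 0) :
    HasDerivAt (fun s => busemann x y (c s)) (busemannDeriv x y (c t) d) t := by
  have h0 := hasDerivAt_apply h 0
  have h1 := hasDerivAt_apply h 1
  have h2 := hasDerivAt_apply h 2
  have hρ : (c t 0 - x) ^ 2 + (c t 1 - y) ^ 2 + c t 2 ^ 2 ≠ 0 := by positivity
  refine ((((((h0.sub_const x).fun_pow 2).fun_add ((h1.sub_const y).fun_pow 2)).fun_add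
    (h2.fun_pow 2)).log hρ).fun_sub (h2.log hc)).congr_deriv ?_
  rw [busemannDeriv]
  simp

theorem continuousOn_busemann (x y : ℝ) {c : ℝ → ShapeSpace} {s : Set ℝ} (h : ContinuousOn c s)
    (hc : ∀ t ∈ s, c t 2 ≠ 0) : ContinuousOn (fun s => busemann x y (c s)) s := by
  have hi : ∀ i, ContinuousOn (fun s => c s i) s := fun i =>
    (EuclideanSpace.proj (𝕜 := ℝ) i).continuous.comp_continuousOn h
  refine ContinuousOn.sub (ContinuousOn.log (((((hi 0).sub continuousOn_const).pow 2).add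
    (((hi 1).sub continuousOn_const).pow 2)).add ((hi 2).pow 2)) fun t ht => ?_)
    (ContinuousOn.log (hi 2) hc)
  have := hc t ht
  simp only
  positivity

theorem integrableOn_jemSpeed {c : ℝ → ShapeSpace} {a b : ℝ} (hab : a < b)
    (h : ContDiffOn ℝ 1 c (Icc a b)) (hc : ∀ t ∈ Icc a b, c t 2 ≠ 0) :
    MeasureTheory.IntegrableOn (fun t => ‖derivWithin c (Icc a b) t‖ / |c t 2|) (Icc a b) := by
  refine ContinuousOn.integrableOn_Icc (ContinuousOn.div
    (h.continuousOn_derivWithin (uniqueDiffOn_Icc hab) le_rfl).norm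
    ((EuclideanSpace.proj (𝕜 := ℝ) (2 : Fin 3)).continuous.comp_continuousOn h.continuousOn).abs
    fun t ht => ?_)
  simpa using hc t ht

theorem hasDerivAt_derivWithin {c : ℝ → ShapeSpace} {a b t : ℝ}
    (h : ContDiffOn ℝ 1 c (Icc a b)) (ht : t ∈ Ioo a b) :
    HasDerivAt c (derivWithin c (Icc a b) t) t :=
  ((h.differentiableOn one_ne_zero t (Ioo_subset_Icc_self ht)).hasDerivWithinAt).hasDerivAt
    (Icc_mem_nhds ht.1 ht.2)

theorem busemann_sub_le_jemLength (x y : ℝ) {c : ℝ → ShapeSpace} {a b : ℝ} (hab : a < b)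
    (h : ContDiffOn ℝ 1 c (Icc a b)) (hc : ∀ t ∈ Icc a b, c t 2 ≠ 0) :
    busemann x y (c b) - busemann x y (c a) ≤ jemLength c a b :=
  intervalIntegral.sub_le_integral_of_hasDeriv_right_of_le hab.le
    (continuousOn_busemann x y h.continuousOn hc)
    (fun t ht => (hasDerivAt_busemann x y (hasDerivAt_derivWithin h ht)
      (hc t (Ioo_subset_Icc_self ht))).hasDerivWithinAt)
    (integrableOn_jemSpeed hab h hc)
    fun t ht => busemannDeriv_le x y (hc t (Ioo_subset_Icc_self ht)) _

/-- A curve moving straight away from the ideal point `(x, y, 0)` has length equal to the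
increment of the Busemann function. -/
theorem jemLength_le_busemann_sub (x y : ℝ) {c : ℝ → ShapeSpace} {a b : ℝ} (hab : a < b)
    (h : ContDiffOn ℝ 1 c (Icc a b)) (hc : ∀ t ∈ Icc a b, c t 2 ≠ 0)
    (hle : ∀ t ∈ Ioo a b, ∀ d, HasDerivAt c d t → ‖d‖ / |c t 2| ≤ busemannDeriv x y (c t) d) :
    jemLength c a b ≤ busemann x y (c b) - busemann x y (c a) :=
  intervalIntegral.integral_le_sub_of_hasDeriv_right_of_le hab.le
    (continuousOn_busemann x y h.continuousOn hc)
    (fun t ht => (hasDerivAt_busemann x y (hasDerivAt_derivWithin h ht)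
      (hc t (Ioo_subset_Icc_self ht))).hasDerivWithinAt)
    (integrableOn_jemSpeed hab h hc)
    fun t ht => hle t ht _ (hasDerivAt_derivWithin h ht)

/-- A curve in a hemisphere whose horizontal projection is affine is a geodesic of the Jemisphere
model. -/
theorem isJemGeodesic_of_affine {S : Set ShapeSpace} {T : Set ℝ} {c : ℝ → ShapeSpace}
    {a₁ b₁ a₂ b₂ α β : ℝ} (hT : IsOpen T) (hb : 0 < b₁ ^ 2 + b₂ ^ 2) (hTI : T ⊆ Ioo α β)
    (hS : ∀ w ∈ S, w 2 ≠ 0) (hc : MapsTo c T S) (hcd : ContDiffOn ℝ 1 c T)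
    (h0 : ∀ t ∈ T, c t 0 = a₁ + b₁ * t) (h1 : ∀ t ∈ T, c t 1 = a₂ + b₂ * t)
    (h2 : ∀ t ∈ T, c t 2 ^ 2 = (b₁ ^ 2 + b₂ ^ 2) * ((t - α) * (β - t))) :
    IsJemGeodesic S T c := by
  have hd : ∀ t ∈ T, ∀ d, HasDerivAt c d t → d 0 = b₁ ∧ d 1 = b₂ ∧
      2 * c t 2 * d 2 = (b₁ ^ 2 + b₂ ^ 2) * (α + β - 2 * t) := by
    intro t ht d hd
    have hTt := hT.mem_nhds ht
    refine ⟨(hasDerivAt_apply hd 0).unique ?_, (hasDerivAt_apply hd 1).unique ?_,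
      HasDerivAt.unique (f := fun s => c s 2 ^ 2) (x := t) ?_ ?_⟩
    · have : HasDerivAt (fun s => a₁ + b₁ * s) b₁ t := by
        simpa using ((hasDerivAt_id' t).const_mul b₁).const_add a₁
      exact this.congr_of_eventuallyEq (Filter.eventually_of_mem hTt h0)
    · have : HasDerivAt (fun s => a₂ + b₂ * s) b₂ t := by
        simpa using ((hasDerivAt_id' t).const_mul b₂).const_add a₂
      exact this.congr_of_eventuallyEq (Filter.eventually_of_mem hTt h1)
    · simpa using (hasDerivAt_apply hd 2).fun_pow 2
    · have : HasDerivAt (fun s => (b₁ ^ 2 + b₂ ^ 2) * ((s - α) * (β - s)))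
          ((b₁ ^ 2 + b₂ ^ 2) * (α + β - 2 * t)) t :=
        ((((hasDerivAt_id' t).sub_const α).fun_mul
          ((hasDerivAt_id' t).const_sub β)).const_mul _).congr_deriv (by ring)
      exact this.congr_of_eventuallyEq (Filter.eventually_of_mem hTt h2)
  -- The radius `1` is arbitrary: every compact arc is minimizing, even among curves that leave the
  -- hemisphere but keep `w₃ ≠ 0`.
  refine ⟨hc, hcd, fun t ht h => ?_, fun t ht => ⟨1, one_pos, fun a b hab hI σ hσ hσS ha hb' => ?_⟩⟩
  · have := hd t ht _ ((hcd.differentiableOn one_ne_zero t ht).differentiableAt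
      (hT.mem_nhds ht)).hasDerivAt
    rw [h] at this
    obtain ⟨e₁, e₂, -⟩ := this
    simp only [PiLp.zero_apply] at e₁ e₂
    rw [← e₁, ← e₂] at hb
    simp at hb
  · have hIT : Icc a b ⊆ T := fun s hs => (hI hs).1
    have hne : ∀ s ∈ Icc a b, c s 2 ≠ 0 := fun s hs => hS _ (hc (hIT hs))
    -- The Busemann center is the ideal endpoint reached at parameter `α`; the curve runs straight
    -- away from it.
    refine (jemLength_le_busemann_sub (a₁ + b₁ * α) (a₂ + b₂ * α) hab (hcd.mono hIT) hne
      fun s hs d hds => ?_).trans ((busemann_sub_le_jemLength _ _ hab hσ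
        fun s hs => hS _ (hσS hs)).trans_eq' (by rw [ha, hb']))
    have hsI := Ioo_subset_Icc_self hs
    have hsT := hIT hsI
    obtain ⟨e₀, e₁, e₂⟩ := hd s hsT d hds
    have hα := sub_pos.2 (hTI hsT).1
    have hβ := sub_pos.2 (hTI hsT).2
    have hw := hne s hsI
    have hw2 := h2 s hsT
    -- Along the curve the Busemann function is `½ log ((t - α)/(β - t))` up to a constant, and this
    -- is its derivative. It equals the hyperbolic speed.
    have hbus : busemannDeriv (a₁ + b₁ * α) (a₂ + b₂ * α) (c s) d =
        (β - α) / (2 * (s - α) * (β - s)) := by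
      have hd2 : d 2 / c s 2 = (b₁ ^ 2 + b₂ ^ 2) * (α + β - 2 * s) / (2 * c s 2 ^ 2) := by
        rw [← e₂]; field_simp
      rw [busemannDeriv, hd2, h0 s hsT, h1 s hsT, e₀, e₁, e₂, hw2]
      have : (a₁ + b₁ * s - (a₁ + b₁ * α)) ^ 2 + (a₂ + b₂ * s - (a₂ + b₂ * α)) ^ 2 +
          (b₁ ^ 2 + b₂ ^ 2) * ((s - α) * (β - s)) =
          (b₁ ^ 2 + b₂ ^ 2) * ((s - α) * (β - α)) := by ring
      rw [this]
      have : β - α ≠ 0 := by linarith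
      field_simp
      ring
    rw [hbus]
    have hαβ : 0 < β - α := by linarith
    refine le_of_sq_le_sq (le_of_eq ?_) (by positivity)
    rw [div_pow, norm_shapeSpace_sq, sq_abs, e₀, e₁]
    have hd2 : d 2 ^ 2 = ((b₁ ^ 2 + b₂ ^ 2) * (α + β - 2 * s)) ^ 2 / (4 * c s 2 ^ 2) := by
      rw [← e₂]; field_simp; ring
    rw [hd2, hw2]
    field_simp
    ring

end ThreeBody
end

/-! ### Continuation of integral curves -/

noncomputable section
namespace ThreeBody
open Set Filter Topology

/-- A curve on an interval `T` whose velocity is bounded near a boundary point of `T` has a limit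
at that point. -/
theorem exists_tendsto_of_eventually_norm_deriv_le {E : Type*} [NormedAddCommGroup E]
    [NormedSpace ℝ E] [CompleteSpace E] {X X' : ℝ → E} {T : Set ℝ} (hT : T.OrdConnected) {t₁ : ℝ}
    (ht₁ : t₁ ∈ closure T) (hX : ∀ t ∈ T, HasDerivAt X (X' t) t) {C : ℝ}
    (hC : ∀ᶠ t in 𝓝[T] t₁, ‖X' t‖ ≤ C) : ∃ x, Tendsto X (𝓝[T] t₁) (𝓝 x) := by
  obtain ⟨δ, hδ, hCδ⟩ := Metric.nhdsWithin_basis_ball.eventually_iff.1 hC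
  have hL : LipschitzOnWith (Real.toNNReal C) X (Metric.ball t₁ δ ∩ T) :=
    ((convex_ball t₁ δ).inter hT.convex).lipschitzOnWith_of_nnnorm_hasDerivWithin_le
      (fun t ht => (hX t ht.2).hasDerivWithinAt) fun t ht => by
        rw [← NNReal.coe_le_coe]
        exact (hCδ ht).trans (Real.le_coe_toNNReal C)
  have : (𝓝[T] t₁).NeBot := mem_closure_iff_nhdsWithin_neBot.1 ht₁
  have hcau : Cauchy (𝓝[T] t₁) := cauchy_nhds.mono nhdsWithin_le_nhds
  exact CompleteSpace.complete (hcau.map_of_le hL.uniformContinuousOn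
    (le_principal_iff.2 (inter_comm _ T ▸ inter_mem_nhdsWithin T (Metric.ball_mem_nhds t₁ hδ))))

/-- Continuation of an integral curve of a `C¹` vector field past a boundary point of its interval
of definition at which it has a limit. -/
theorem exists_extension {E : Type*} [NormedAddCommGroup E] [NormedSpace ℝ E] [CompleteSpace E]
    {f : E → E} {X : ℝ → E} {T : Set ℝ} {U : Set E} (hTo : IsOpen T) (hT : T.OrdConnected)
    (hX : ∀ t ∈ T, HasDerivAt X (f (X t)) t) (hXU : MapsTo X T U) (hU : IsOpen U) {t₁ : ℝ}
    (ht₁ : t₁ ∈ closure T) (ht₁' : t₁ ∉ T) {x : E} (hx : Tendsto X (𝓝[T] t₁) (𝓝 x)) (hxU : x ∈ U)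
    (hf : ContDiffAt ℝ 1 f x) :
    ∃ (T' : Set ℝ) (X' : ℝ → E), IsOpen T' ∧ T'.OrdConnected ∧ T ⊆ T' ∧ t₁ ∈ T' ∧ EqOn X' X T ∧
      MapsTo X' T' U ∧ ∀ t ∈ T', HasDerivAt X' (f (X' t)) t := by
  classical
  obtain ⟨Y, hY₁, ε, hε, hY⟩ :=
      hf.exists_forall_mem_closedBall_exists_eq_forall_mem_Ioo_hasDerivAt₀ t₁
  have hYc : ContinuousAt Y t₁ := (hY t₁ ⟨by linarith, by linarith⟩).continuousAt
  obtain ⟨ε', hε', hYU⟩ : ∃ ε' > 0, ∀ t ∈ Metric.ball t₁ ε', Y t ∈ U :=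
    Metric.eventually_nhds_iff_ball.1 (hYc.eventually (hU.mem_nhds (by rwa [hY₁])))
  have : (𝓝[T] t₁).NeBot := mem_closure_iff_nhdsWithin_neBot.1 ht₁
  obtain ⟨s₀, hs₀⟩ : T.Nonempty := closure_nonempty_iff.1 ⟨t₁, ht₁⟩
  have hs₀₁ : s₀ ≠ t₁ := fun h => ht₁' (h ▸ hs₀)
  -- The third bound keeps the ball from reaching past `s₀ ∈ T`, so within it `T` fills exactly one
  -- side of `t₁`.
  set δ := min (min ε ε') |t₁ - s₀| with hδ
  have hδ0 : 0 < δ := lt_min (lt_min hε hε') (abs_pos.2 (sub_ne_zero.2 hs₀₁.symm))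
  have hδε : δ ≤ ε := (min_le_left _ _).trans (min_le_left _ _)
  have hδε' : δ ≤ ε' := (min_le_left _ _).trans (min_le_right _ _)
  have hδs : δ ≤ |t₁ - s₀| := min_le_right _ _
  -- a point of the ball outside `T` is interior to the complement, apart from `t₁`
  have hsep : ∀ t ∈ Ioo (t₁ - δ) (t₁ + δ), t ∉ T → t ≠ t₁ → t ∉ closure T := by
    intro t ht htT htt₁ htc
    rcases lt_or_gt_of_ne hs₀₁ with h | h
    · rw [abs_of_pos (sub_pos.2 h)] at hδs
      rcases lt_or_gt_of_ne htt₁ with h' | h'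
      · obtain ⟨r, hr, hrT⟩ := mem_closure_iff.1 ht₁ (Ioi t) isOpen_Ioi h'
        exact htT (hT.out hs₀ hrT ⟨by linarith [ht.1], le_of_lt hr⟩)
      · obtain ⟨r, hr, hrT⟩ := mem_closure_iff.1 htc (Ioi t₁) isOpen_Ioi h'
        exact ht₁' (hT.out hs₀ hrT ⟨h.le, le_of_lt hr⟩)
    · rw [abs_of_neg (sub_neg.2 h)] at hδs
      rcases lt_or_gt_of_ne htt₁ with h' | h'
      · obtain ⟨r, hr, hrT⟩ := mem_closure_iff.1 htc (Iio t₁) isOpen_Iio h'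
        exact ht₁' (hT.out hrT hs₀ ⟨le_of_lt hr, h.le⟩)
      · obtain ⟨r, hr, hrT⟩ := mem_closure_iff.1 ht₁ (Iio t) isOpen_Iio h'
        exact htT (hT.out hrT hs₀ ⟨le_of_lt hr, by linarith [ht.2]⟩)
  have hball : Ioo (t₁ - δ) (t₁ + δ) ∈ 𝓝 t₁ := Ioo_mem_nhds (by linarith) (by linarith)
  -- Gluing along `T` avoids uniqueness of integral curves: `Y` is used only at `t₁` and beyond it.
  set X' : ℝ → E := T.piecewise X Y with hX'
  have hX'T : EqOn X' X T := piecewise_eqOn _ _ _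
  have hX'Y : EqOn X' Y Tᶜ := piecewise_eqOn_compl _ _ _
  have hX'₁ : X' t₁ = x := by rw [hX'Y ht₁', hY₁]
  refine ⟨T ∪ Ioo (t₁ - δ) (t₁ + δ), X', hTo.union isOpen_Ioo, ?_, subset_union_left,
    Or.inr ⟨by linarith, by linarith⟩, hX'T, ?_, ?_⟩
  · have h1 : IsPreconnected T := hT.isPreconnected
    obtain ⟨r, hr, hrT⟩ := mem_closure_iff_nhds.1 ht₁ _ hball
    exact (h1.union r hrT hr isPreconnected_Ioo).ordConnected
  · intro t ht
    by_cases htT : t ∈ T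
    · rw [hX'T htT]; exact hXU htT
    · rw [hX'Y htT]
      have h := ht.resolve_left htT
      exact hYU t (by rw [Real.ball_eq_Ioo]; exact ⟨by linarith [h.1], by linarith [h.2]⟩)
  · intro t ht
    by_cases htT : t ∈ T
    · rw [hX'T htT]
      exact (hX t htT).congr_of_eventuallyEq (eventually_of_mem (hTo.mem_nhds htT) hX'T)
    have h := ht.resolve_left htT
    have hYt : HasDerivAt Y (f (Y t)) t := hY t ⟨by linarith [h.1], by linarith [h.2]⟩
    by_cases htt : t = t₁
    · subst htt
      have hlim : Tendsto X' (𝓝[T] t) (𝓝 (X' t)) := by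
        rw [hX'₁]
        exact hx.congr' (eventually_of_mem self_mem_nhdsWithin fun s hs => (hX'T hs).symm)
      have hfl : Tendsto (fun s => f (X s)) (𝓝[T] t) (𝓝 (f (X' t))) := by
        rw [hX'₁]
        exact hf.continuousAt.tendsto.comp hx
      have hd : ∀ s ∈ T, HasDerivAt X' (f (X s)) s := fun s hs =>
        (hX s hs).congr_of_eventuallyEq (eventually_of_mem (hTo.mem_nhds hs) hX'T)
      -- At the junction the derivative from the side of `T` is the limit of the nearby derivatives;
      -- the other side inherits it from `Y`, and the two one-sided derivatives agree.
      have hder : HasFDerivWithinAt X' (ContinuousLinearMap.toSpanSingleton ℝ (f (X' t)))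
          (closure (T ∩ Ioo (t - δ / 2) (t + δ / 2))) t := by
        refine hasFDerivWithinAt_closure_of_tendsto_fderiv
          (fun s hs => (hd s hs.1).differentiableAt.differentiableWithinAt)
          (hT.convex.inter (convex_Ioo _ _)) (hTo.inter isOpen_Ioo) (fun s hs => ?_) ?_
        · have hs₁ : s ∈ closure T := closure_mono inter_subset_left hs
          have hs₂ : s ∈ Icc (t - δ / 2) (t + δ / 2) :=
            closure_minimal (inter_subset_right.trans Ioo_subset_Icc_self) isClosed_Icc hs
          by_cases hst : s = t
          · subst hst
            exact hlim.mono_left (nhdsWithin_mono _ inter_subset_left)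
          · have hsT : s ∈ T := by
              by_contra hsT
              exact hsep s ⟨by linarith [hs₂.1], by linarith [hs₂.2]⟩ hsT hst hs₁
            exact (hd s hsT).continuousAt.continuousWithinAt
        · have : Tendsto (fun s => ContinuousLinearMap.toSpanSingleton ℝ (f (X s)))
              (𝓝[T ∩ Ioo (t - δ / 2) (t + δ / 2)] t)
              (𝓝 (ContinuousLinearMap.toSpanSingleton ℝ (f (X' t)))) :=
            ((ContinuousLinearMap.toSpanSingletonCLE (𝕜 := ℝ) (E := E)).continuous.tendsto _).comp
              (hfl.mono_left (nhdsWithin_mono _ inter_subset_left))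
          exact this.congr' (eventually_of_mem self_mem_nhdsWithin fun s hs =>
            (hd s hs.1).hasFDerivAt.fderiv.symm)
      have hδ2 : Ioo (t - δ / 2) (t + δ / 2) ∈ 𝓝 t := Ioo_mem_nhds (by linarith) (by linarith)
      have h1 : HasDerivWithinAt X' (f (X' t)) T t :=
        (hasDerivWithinAt_inter hδ2).1
          (hasDerivWithinAt_iff_hasFDerivWithinAt.2 (hder.mono subset_closure))
      have h2 : HasDerivWithinAt X' (f (X' t)) Tᶜ t := by
        rw [hX'Y htT]
        exact hYt.hasDerivWithinAt.congr hX'Y (hX'Y htT)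
      have := h1.union h2
      rwa [union_compl_self, hasDerivWithinAt_univ] at this
    · rw [hX'Y htT]
      exact hYt.congr_of_eventuallyEq (eventually_of_mem
        (isClosed_closure.isOpen_compl.mem_nhds (hsep t h htT htt))
        fun s hs => hX'Y fun hsT => hs (subset_closure hsT))

end ThreeBody
end

/-! ### From Newton's equations to shape space -/

noncomputable section
namespace ThreeBody
open Set Filter Topology

variable {m : Fin 3 → ℝ} {γ : ℝ} {T : Set ℝ} {q : ℝ → Config}

theorem hasDerivAt_re {f : ℝ → ℂ} {f' : ℂ} {t : ℝ} (h : HasDerivAt f f' t) :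
    HasDerivAt (fun s => (f s).re) f'.re t :=
  Complex.reCLM.hasFDerivAt.comp_hasDerivAt t h

theorem hasDerivAt_im {f : ℝ → ℂ} {f' : ℂ} {t : ℝ} (h : HasDerivAt f f' t) :
    HasDerivAt (fun s => (f s).im) f'.im t :=
  Complex.imCLM.hasFDerivAt.comp_hasDerivAt t h

theorem hasDerivAt_jacobi₁ (m : Fin 3 → ℝ) {X : ℝ → Config} {X' : Config} {t : ℝ}
    (h : ∀ a, HasDerivAt (fun s => X s a) (X' a) t) :
    HasDerivAt (fun s => jacobi₁ m (X s)) (jacobi₁ m X') t :=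
  ((h 1).fun_sub (h 0)).const_mul _

theorem hasDerivAt_jacobi₂ (m : Fin 3 → ℝ) {X : ℝ → Config} {X' : Config} {t : ℝ}
    (h : ∀ a, HasDerivAt (fun s => X s a) (X' a) t) :
    HasDerivAt (fun s => jacobi₂ m (X s)) (jacobi₂ m X') t :=
  ((h 2).fun_sub ((((h 0).const_mul _).fun_add ((h 1).const_mul _)).div_const _)).const_mul _

theorem IsNewtonSolution.hasDerivAt_velocity (hm : ∀ a, 0 < m a) (hq : IsNewtonSolution m γ T q)
    {t : ℝ} (ht : t ∈ T) (a : Fin 3) :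
    HasDerivAt (fun s => velocity q s a) (acceleration m γ (q t) a) t := by
  rw [← (accel_of_newton hm γ (hq.area_ne_zero t ht) a _).1 (hq.newton t ht a)]
  exact (hq.differentiableAt_velocity t ht a).hasDerivAt

theorem IsNewtonSolution.hasDerivAt (hq : IsNewtonSolution m γ T q)
    {t : ℝ} (ht : t ∈ T) (a : Fin 3) :
    HasDerivAt (fun s => q s a) (velocity q t a) t :=
  (hq.differentiableAt t ht a).hasDerivAt

/-- Turns an integral curve of the first-order system in phase space back into a Newton solution, as
continuation requires. Openness of `T` transfers derivatives from `v` to `velocity q`. -/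
theorem isNewtonSolution_of_hasDerivAt (hm : ∀ a, 0 < m a) (hTo : IsOpen T) (hT : T.OrdConnected)
    (hTn : T.Nonempty) {v : ℝ → Config} (hd : ∀ t ∈ T, signedArea (q t) ≠ 0)
    (hq : ∀ t ∈ T, ∀ a, HasDerivAt (fun s => q s a) (v t a) t)
    (hv : ∀ t ∈ T, ∀ a, HasDerivAt (fun s => v s a) (acceleration m γ (q t) a) t) :
    IsNewtonSolution m γ T q := by
  have hvel : ∀ t ∈ T, ∀ a, velocity q t a = v t a := fun t ht a => (hq t ht a).deriv
  have hv' : ∀ t ∈ T, ∀ a,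
      HasDerivAt (fun s => velocity q s a) (acceleration m γ (q t) a) t := fun t ht a =>
    (hv t ht a).congr_of_eventuallyEq
      (eventually_of_mem (hTo.mem_nhds ht) fun s hs => hvel s hs a)
  exact
    { isOpen := hTo
      ordConnected := hT
      nonempty := hTn
      area_ne_zero := hd
      differentiableAt := fun t ht a => (hq t ht a).differentiableAt
      differentiableAt_velocity := fun t ht a => (hv' t ht a).differentiableAt
      newton := fun t ht a =>
        (accel_of_newton hm γ (hd t ht) a _).2 (hv' t ht a).deriv }

/-- The constant `κ` for which the potential is `-κ I / w₃²` in Hopf-Jacobi coordinates. -/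
def hopfCoupling (m : Fin 3 → ℝ) (γ : ℝ) : ℝ :=
  4 * γ * √(m 0 * m 1 / (m 0 + m 1)) ^ 2 * √(m 2 * (m 0 + m 1) / (m 0 + m 1 + m 2)) ^ 2

theorem IsNewtonSolution.isJacobiSolution (hm : ∀ a, 0 < m a) (hq : IsNewtonSolution m γ T q) :
    IsJacobiSolution (hopfCoupling m γ) T (fun t => (jacobi₁ m (q t)).re)
      (fun t => (jacobi₁ m (q t)).im) (fun t => (jacobi₂ m (q t)).re)
      (fun t => (jacobi₂ m (q t)).im) (fun t => (jacobi₁ m (velocity q t)).re)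
      (fun t => (jacobi₁ m (velocity q t)).im) (fun t => (jacobi₂ m (velocity q t)).re)
      (fun t => (jacobi₂ m (velocity q t)).im) := by
  have h1 := fun t (ht : t ∈ T) => hasDerivAt_jacobi₁ m (hq.hasDerivAt ht)
  have h2 := fun t (ht : t ∈ T) => hasDerivAt_jacobi₂ m (hq.hasDerivAt ht)
  have h3 := fun t (ht : t ∈ T) => hasDerivAt_jacobi₁ m (hq.hasDerivAt_velocity hm ht)
  have h4 := fun t (ht : t ∈ T) => hasDerivAt_jacobi₂ m (hq.hasDerivAt_velocity hm ht)
  have e1 := fun t (ht : t ∈ T) => jacobi₁_acceleration hm γ rfl (wedge_jacobi m hm (q t))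
    (momentOfInertia_eq hm (q t)) (hq.area_ne_zero t ht)
  have e2 := fun t (ht : t ∈ T) => jacobi₂_acceleration hm γ rfl (wedge_jacobi m hm (q t))
    (momentOfInertia_eq hm (q t)) (hq.area_ne_zero t ht)
  refine ⟨fun t ht => ?_, fun t ht => hasDerivAt_re (h1 t ht), fun t ht => hasDerivAt_im (h1 t ht),
    fun t ht => hasDerivAt_re (h2 t ht), fun t ht => hasDerivAt_im (h2 t ht),
    fun t ht => (hasDerivAt_re (h3 t ht)).congr_deriv ?_,
    fun t ht => (hasDerivAt_im (h3 t ht)).congr_deriv ?_,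
    fun t ht => (hasDerivAt_re (h4 t ht)).congr_deriv ?_,
    fun t ht => (hasDerivAt_im (h4 t ht)).congr_deriv ?_⟩
  · rw [wedge_jacobi m hm]
    have := scale₁_pos hm
    have := scale₂_pos hm
    have := hq.area_ne_zero t ht
    positivity
  · rw [e1 t ht, Complex.add_re, Complex.re_ofReal_mul, Complex.re_ofReal_mul, Complex.I_mul_re,
      hopfCoupling]
    ring
  · rw [e1 t ht, Complex.add_im, Complex.im_ofReal_mul, Complex.im_ofReal_mul, Complex.I_mul_im,
      hopfCoupling]
    ring
  · rw [e2 t ht, Complex.sub_re, Complex.re_ofReal_mul, Complex.re_ofReal_mul, Complex.I_mul_re,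
      hopfCoupling]
    ring
  · rw [e2 t ht, Complex.sub_im, Complex.im_ofReal_mul, Complex.im_ofReal_mul, Complex.I_mul_im,
      hopfCoupling]
    ring

theorem shapeProj_zero (m : Fin 3 → ℝ) (q : Config) : shapeProj m q 0 =
    ((jacobi₁ m q).re ^ 2 + (jacobi₁ m q).im ^ 2 -
      ((jacobi₂ m q).re ^ 2 + (jacobi₂ m q).im ^ 2)) / 2 := by
  simp [shapeProj, Complex.sq_norm, Complex.normSq_apply]
  ring

theorem shapeProj_one (m : Fin 3 → ℝ) (q : Config) : shapeProj m q 1 =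
    (jacobi₁ m q).re * (jacobi₂ m q).re + (jacobi₁ m q).im * (jacobi₂ m q).im := by
  simp [shapeProj, Complex.inner]
  ring

theorem shapeProj_two (m : Fin 3 → ℝ) (q : Config) : shapeProj m q 2 =
    (jacobi₁ m q).re * (jacobi₂ m q).im - (jacobi₁ m q).im * (jacobi₂ m q).re := by
  simp [shapeProj, wedge]

/-- The Hopf identity: `(Z₁ · Z₂)² + (Z₁ ∧ Z₂)² = |Z₁|²|Z₂|²`, which completes the square of half
the difference to that of half the sum. -/
theorem shapeProj_norm_sq (hm : ∀ a, 0 < m a) (q : Config) :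
    shapeProj m q 0 ^ 2 + shapeProj m q 1 ^ 2 + shapeProj m q 2 ^ 2 =
      momentOfInertia m q ^ 2 / 4 := by
  rw [shapeProj_zero, shapeProj_one, shapeProj_two, momentOfInertia_eq hm]
  ring

/-- The energy in Hopf-Jacobi coordinates. -/
theorem energy_eq (hm : ∀ a, 0 < m a) {q v : Config} (hq : signedArea q ≠ 0)
    (hv : linearMomentum m v = 0) :
    energy m γ q v = ((jacobi₁ m v).re ^ 2 + (jacobi₁ m v).im ^ 2 + (jacobi₂ m v).re ^ 2 +
      (jacobi₂ m v).im ^ 2) / 2 - hopfCoupling m γ *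
      ((jacobi₁ m q).re ^ 2 + (jacobi₁ m q).im ^ 2 + (jacobi₂ m q).re ^ 2 +
        (jacobi₂ m q).im ^ 2) /
        ((jacobi₁ m q).re * (jacobi₂ m q).im - (jacobi₁ m q).im * (jacobi₂ m q).re) ^ 2 := by
  rw [energy, kineticEnergy_eq hm v hv, potential, ← momentOfInertia_eq hm q, wedge_jacobi m hm,
    hopfCoupling]
  have := scale₁_pos hm
  have := scale₂_pos hm
  generalize √(m 0 * m 1 / (m 0 + m 1)) = s₁ at *
  generalize √(m 2 * (m 0 + m 1) / (m 0 + m 1 + m 2)) = s₂ at *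
  field_simp
  ring

/-- Along a solution with `H = 0`, `P = 0`, `J = 0`, `İ = 0`, the size of the triangle is constant
and the horizontal projection of the shape curve is a straight line, traversed with constant
nonzero velocity. -/
theorem IsNewtonSolution.shapeProj_affine (hm : ∀ a, 0 < m a) (hγ : 0 < γ)
    (hq : IsNewtonSolution m γ T q) {t₀ : ℝ} (ht₀ : t₀ ∈ T)
    (hH : energy m γ (q t₀) (velocity q t₀) = 0)
    (hI : deriv (fun t => momentOfInertia m (q t)) t₀ = 0)
    (hJ : angularMomentum m (q t₀) (velocity q t₀) = 0)
    (hP : linearMomentum m (velocity q t₀) = 0) :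
    (∀ t ∈ T, momentOfInertia m (q t) = momentOfInertia m (q t₀)) ∧
    ∃ a₁ b₁ a₂ b₂ : ℝ, (b₁ ≠ 0 ∨ b₂ ≠ 0) ∧ ∀ t ∈ T,
      shapeProj m (q t) 0 = a₁ + b₁ * t ∧ shapeProj m (q t) 1 = a₂ + b₂ * t := by
  have hs := hq.isJacobiSolution hm
  have hκ : 0 < hopfCoupling m γ := by
    have := scale₁_pos hm
    have := scale₂_pos hm
    rw [hopfCoupling]
    positivity
  rw [angularMomentum_eq hm _ _ hP] at hJ
  rw [energy_eq hm (hq.area_ne_zero t₀ ht₀) hP] at hH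
  have hr : (jacobi₁ m (q t₀)).re * (jacobi₁ m (velocity q t₀)).re +
      (jacobi₁ m (q t₀)).im * (jacobi₁ m (velocity q t₀)).im +
      (jacobi₂ m (q t₀)).re * (jacobi₂ m (velocity q t₀)).re +
      (jacobi₂ m (q t₀)).im * (jacobi₂ m (velocity q t₀)).im = 0 := by
    have h := ((((hs.x₁' t₀ ht₀).fun_pow 2).fun_add ((hs.y₁' t₀ ht₀).fun_pow 2)).fun_add
      ((hs.x₂' t₀ ht₀).fun_pow 2)).fun_add ((hs.y₂' t₀ ht₀).fun_pow 2)
    simp only [momentOfInertia_eq hm] at hI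
    rw [h.deriv] at hI
    push_cast at hI
    linarith
  refine ⟨fun t ht => ?_, ?_⟩
  · rw [momentOfInertia_eq hm, momentOfInertia_eq hm]
    exact hs.inertia_eq hq.ordConnected ht₀ ht hH hr
  · obtain ⟨a₁, b₁, a₂, b₂, hb, h⟩ := hs.hopf_affine hq.ordConnected hκ ht₀ hH hr hJ
    exact ⟨a₁, b₁, a₂, b₂, hb, fun t ht =>
      ⟨(shapeProj_zero m _).trans (h t ht).1, (shapeProj_one m _).trans (h t ht).2⟩⟩

end ThreeBody
end

/-! ### Extending solutions of constant size -/

noncomputable section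
namespace ThreeBody
open Set Filter Topology

variable {m : Fin 3 → ℝ} {γ : ℝ} {T : Set ℝ} {q : ℝ → Config}

/-- Positive masses make `I` control all mutual distances. The constant is crude but symmetric in
the pairs: expanding the product recovers each squared distance plus nonnegative terms. -/
theorem norm_sub_sq_le (hm : ∀ a, 0 < m a) (q : Config) (a b : Fin 3) :
    ‖q a - q b‖ ^ 2 ≤ (m 0 + m 1 + m 2) * momentOfInertia m q *
      (1 / (m 0 * m 1) + 1 / (m 0 * m 2) + 1 / (m 1 * m 2)) := by
  have h0 := hm 0
  have h1 := hm 1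
  have h2 := hm 2
  have hI : (m 0 + m 1 + m 2) * momentOfInertia m q = m 0 * m 1 * ‖q 0 - q 1‖ ^ 2 +
      m 0 * m 2 * ‖q 0 - q 2‖ ^ 2 + m 1 * m 2 * ‖q 1 - q 2‖ ^ 2 := by
    rw [momentOfInertia]
    field_simp
  rw [hI]
  have key : ‖q 0 - q 1‖ ^ 2 + ‖q 0 - q 2‖ ^ 2 + ‖q 1 - q 2‖ ^ 2 ≤
      (m 0 * m 1 * ‖q 0 - q 1‖ ^ 2 +
      m 0 * m 2 * ‖q 0 - q 2‖ ^ 2 + m 1 * m 2 * ‖q 1 - q 2‖ ^ 2) *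
      (1 / (m 0 * m 1) + 1 / (m 0 * m 2) + 1 / (m 1 * m 2)) := by
    rw [← sub_nonneg]
    have : (m 0 * m 1 * ‖q 0 - q 1‖ ^ 2 +
      m 0 * m 2 * ‖q 0 - q 2‖ ^ 2 + m 1 * m 2 * ‖q 1 - q 2‖ ^ 2) *
      (1 / (m 0 * m 1) + 1 / (m 0 * m 2) + 1 / (m 1 * m 2)) -
      (‖q 0 - q 1‖ ^ 2 + ‖q 0 - q 2‖ ^ 2 + ‖q 1 - q 2‖ ^ 2) =
      m 0 * m 1 * ‖q 0 - q 1‖ ^ 2 * (1 / (m 0 * m 2) + 1 / (m 1 * m 2)) +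
      m 0 * m 2 * ‖q 0 - q 2‖ ^ 2 * (1 / (m 0 * m 1) + 1 / (m 1 * m 2)) +
      m 1 * m 2 * ‖q 1 - q 2‖ ^ 2 * (1 / (m 0 * m 1) + 1 / (m 0 * m 2)) := by
      field_simp
      ring
    rw [this]
    positivity
  refine le_trans ?_ key
  have p1 := sq_nonneg ‖q 0 - q 1‖
  have p2 := sq_nonneg ‖q 0 - q 2‖
  have p3 := sq_nonneg ‖q 1 - q 2‖
  have s1 := norm_sub_rev (q 1) (q 0)
  have s2 := norm_sub_rev (q 2) (q 0)
  have s3 := norm_sub_rev (q 2) (q 1)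
  fin_cases a <;> fin_cases b <;> simp [s1, s2, s3] <;> linarith

/-- The accelerations are bounded on the set of triangles of given size and of area bounded away
from zero. -/
theorem exists_norm_acceleration_le (hm : ∀ a, 0 < m a) (hγ : 0 < γ) (i : ℝ) {ε : ℝ} (hε : 0 < ε) :
    ∃ C, ∀ q : Config, momentOfInertia m q = i → ε ≤ |signedArea q| →
      ‖acceleration m γ q‖ ≤ C := by
  have h0 := hm 0
  have h1 := hm 1
  have h2 := hm 2
  set R := √((m 0 + m 1 + m 2) * i *
      (1 / (m 0 * m 1) + 1 / (m 0 * m 2) + 1 / (m 1 * m 2))) with hR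
  have hR0 : 0 ≤ R := Real.sqrt_nonneg _
  set B : Fin 3 → ℝ := fun a => 2 * γ / ((m 0 + m 1 + m 2) * ε ^ 2) *
    (m (a + 1) * R + m (a + 2) * R) + γ * |i| / (m a * ε ^ 3) * R with hB
  have hB0 : ∀ a, 0 ≤ B a := fun a => by
    have := hm a
    have := hm (a + 1)
    have := hm (a + 2)
    positivity
  refine ⟨∑ a, B a, fun q hi hΔ => (pi_norm_le_iff_of_nonneg
    (Finset.sum_nonneg fun a _ => hB0 a)).2 fun a => le_trans ?_
    (Finset.single_le_sum (fun a _ => hB0 a) (Finset.mem_univ a))⟩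
  have hd : ∀ a b, ‖q a - q b‖ ≤ R := fun a b =>
    Real.le_sqrt_of_sq_le (hi ▸ norm_sub_sq_le hm q a b)
  have ha := hm a
  have ha1 := hm (a + 1)
  have ha2 := hm (a + 2)
  have hΔ0 : 0 < |signedArea q| := hε.trans_le hΔ
  refine (norm_add_le _ _).trans (add_le_add ?_ ?_)
  · rw [norm_mul, Complex.norm_real, Real.norm_eq_abs, abs_div, abs_mul (m 0 + m 1 + m 2), abs_pow,
      abs_of_pos (by positivity : 0 < 2 * γ), abs_of_pos (by positivity : 0 < m 0 + m 1 + m 2)]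
    gcongr
    refine (norm_add_le _ _).trans (add_le_add ?_ ?_) <;>
      rw [norm_mul, Complex.norm_real, Real.norm_of_nonneg (by positivity)] <;>
      gcongr <;> exact hd _ _
  · rw [norm_mul, Complex.norm_real, Real.norm_eq_abs, abs_div, abs_mul, abs_mul (m a), abs_pow, hi,
      abs_of_pos hγ, abs_of_pos ha, norm_mul, Complex.norm_I, one_mul]
    gcongr
    exact hd _ _

theorem contDiff_signedArea : ContDiff ℝ 1 signedArea := by
  have hre : ∀ a : Fin 3, ContDiff ℝ 1 fun q : Config => (q a).re := fun a =>
    Complex.reCLM.contDiff.comp (contDiff_apply ℝ ℂ a)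
  have him : ∀ a : Fin 3, ContDiff ℝ 1 fun q : Config => (q a).im := fun a =>
    Complex.imCLM.contDiff.comp (contDiff_apply ℝ ℂ a)
  exact ((((hre 1).sub (hre 0)).mul ((him 2).sub (him 0))).sub
    (((him 1).sub (him 0)).mul ((hre 2).sub (hre 0)))).div_const 2

theorem contDiff_momentOfInertia (m : Fin 3 → ℝ) : ContDiff ℝ 1 (momentOfInertia m) := by
  have h : ∀ a b : Fin 3, ContDiff ℝ 1 fun q : Config => ‖q a - q b‖ ^ 2 := fun a b =>
    ((contDiff_apply ℝ ℂ a).sub (contDiff_apply ℝ ℂ b)).norm_sq ℝ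
  exact (((contDiff_const.mul (h 0 1)).add (contDiff_const.mul (h 0 2))).add
    (contDiff_const.mul (h 1 2))).div_const _

theorem contDiffAt_acceleration (hm : ∀ a, 0 < m a) (γ : ℝ) {q : Config} (hq : signedArea q ≠ 0) :
    ContDiffAt ℝ 1 (acceleration m γ) q := by
  refine contDiffAt_pi.2 fun a => ?_
  have hc : ∀ a : Fin 3, ContDiffAt ℝ 1 (fun q : Config => q a) q := fun a =>
    (contDiff_apply ℝ ℂ a).contDiffAt
  have hM : m 0 + m 1 + m 2 ≠ 0 := (add_pos (add_pos (hm 0) (hm 1)) (hm 2)).ne'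
  have hΔ := contDiff_signedArea.contDiffAt (x := q)
  refine ((Complex.ofRealCLM.contDiff.contDiffAt.comp q (contDiffAt_const.div
    (contDiffAt_const.mul (hΔ.pow 2)) (by positivity))).mul
    ((contDiffAt_const.mul ((hc a).sub (hc _))).add
      (contDiffAt_const.mul ((hc a).sub (hc _))))).add
    ((Complex.ofRealCLM.contDiff.contDiffAt.comp q ((contDiffAt_const.mul
      (contDiff_momentOfInertia m).contDiffAt).div (contDiffAt_const.mul (hΔ.pow 3)) ?_)).mul
    (contDiffAt_const.mul ((hc _).sub (hc _))))
  have := hm a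
  positivity

/-- A solution of constant size can be continued past any time at which the area of the triangle
stays away from zero. -/
theorem IsNewtonSolution.exists_extension (hm : ∀ a, 0 < m a) (hγ : 0 < γ)
    (hq : IsNewtonSolution m γ T q) {i : ℝ} (hi : ∀ t ∈ T, momentOfInertia m (q t) = i) {t₁ : ℝ}
    (ht₁ : t₁ ∈ closure T) (ht₁' : t₁ ∉ T) {ε : ℝ} (hε : 0 < ε)
    (hΔ : ∀ᶠ t in 𝓝[T] t₁, ε ≤ |signedArea (q t)|) :
    ∃ (T' : Set ℝ) (q' : ℝ → Config), IsNewtonSolution m γ T' q' ∧ T ⊆ T' ∧ EqOn q q' T ∧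
      t₁ ∈ T' := by
  have hne : (𝓝[T] t₁).NeBot := mem_closure_iff_nhdsWithin_neBot.1 ht₁
  have hdq : ∀ t ∈ T, HasDerivAt q (velocity q t) t := fun t ht =>
    hasDerivAt_pi.2 (hq.hasDerivAt ht)
  have hdv : ∀ t ∈ T, HasDerivAt (velocity q) (acceleration m γ (q t)) t := fun t ht =>
    hasDerivAt_pi.2 (hq.hasDerivAt_velocity hm ht)
  obtain ⟨C, hC⟩ := exists_norm_acceleration_le hm hγ i hε
  -- Bounded accelerations give the velocities a limit; the velocities are then bounded near `t₁`,
  -- so the positions have a limit too.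
  obtain ⟨v₁, hv₁⟩ := exists_tendsto_of_eventually_norm_deriv_le hq.ordConnected ht₁ hdv
    (C := C) (by
      filter_upwards [hΔ, self_mem_nhdsWithin] with t ht htT using hC _ (hi t htT) ht)
  obtain ⟨q₁, hq₁⟩ := exists_tendsto_of_eventually_norm_deriv_le hq.ordConnected ht₁ hdq
    (C := ‖v₁‖ + 1) (by
      filter_upwards [hv₁.norm.eventually_lt_const (lt_add_one ‖v₁‖)] with t ht using ht.le)
  have hΔ₁ : signedArea q₁ ≠ 0 := by
    have : Tendsto (fun t => |signedArea (q t)|) (𝓝[T] t₁) (𝓝 |signedArea q₁|) :=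
      ((contDiff_signedArea.continuous.tendsto q₁).comp hq₁).abs
    exact abs_pos.1 (hε.trans_le (ge_of_tendsto this hΔ))
  have hU : IsOpen {x : Config × Config | signedArea x.1 ≠ 0} :=
    isOpen_ne_fun (contDiff_signedArea.continuous.comp continuous_fst) continuous_const
  have hf : ContDiffAt ℝ 1 (fun x : Config × Config => (x.2, acceleration m γ x.1)) (q₁, v₁) :=
    contDiffAt_snd.prodMk (ContDiffAt.comp (q₁, v₁) (contDiffAt_acceleration hm γ hΔ₁)
      contDiffAt_fst)
  obtain ⟨T', X', hT'o, hT', hTT', ht₁T', hX'T, hX'U, hX'⟩ :=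
    ThreeBody.exists_extension (f := fun x : Config × Config => (x.2, acceleration m γ x.1))
      (X := fun t => (q t, velocity q t)) hq.isOpen hq.ordConnected
      (fun t ht => (hdq t ht).prodMk (hdv t ht)) (U := {x | signedArea x.1 ≠ 0})
      (fun t ht => hq.area_ne_zero t ht) hU ht₁ ht₁' (hq₁.prodMk_nhds hv₁) hΔ₁ hf
  refine ⟨T', fun t => (X' t).1, isNewtonSolution_of_hasDerivAt hm hT'o hT' ⟨t₁, ht₁T'⟩
    (v := fun t => (X' t).2) hX'U (fun t ht => hasDerivAt_pi.1 (hX' t ht).fst)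
    (fun t ht => hasDerivAt_pi.1 (hX' t ht).snd), hTT', fun t ht => ?_, ht₁T'⟩
  simp [hX'T ht]

/-- A quadratic with negative leading coefficient that is positive somewhere has real roots. Here
`s` is the vertex and `√D` half the distance between the roots. -/
theorem sub_sq_sub_sq_eq_mul {r a₁ b₁ a₂ b₂ t₀ : ℝ} (hb : 0 < b₁ ^ 2 + b₂ ^ 2)
    (h : 0 < r - (a₁ + b₁ * t₀) ^ 2 - (a₂ + b₂ * t₀) ^ 2) :
    ∃ α β : ℝ, α ≤ β ∧ ∀ t, r - (a₁ + b₁ * t) ^ 2 - (a₂ + b₂ * t) ^ 2 =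
      (b₁ ^ 2 + b₂ ^ 2) * ((t - α) * (β - t)) := by
  set s := -(a₁ * b₁ + a₂ * b₂) / (b₁ ^ 2 + b₂ ^ 2) with hs
  have hs' : s * (b₁ ^ 2 + b₂ ^ 2) = -(a₁ * b₁ + a₂ * b₂) := by
    rw [hs]; field_simp
  set D := (r - a₁ ^ 2 - a₂ ^ 2) / (b₁ ^ 2 + b₂ ^ 2) + s ^ 2 with hD
  have hD' : D * (b₁ ^ 2 + b₂ ^ 2) = r - a₁ ^ 2 - a₂ ^ 2 + s ^ 2 * (b₁ ^ 2 + b₂ ^ 2) := by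
    rw [hD]; field_simp
  have hN : ∀ t, r - (a₁ + b₁ * t) ^ 2 - (a₂ + b₂ * t) ^ 2 =
      (b₁ ^ 2 + b₂ ^ 2) * (D - (t - s) ^ 2) := fun t => by
    linear_combination -hD' - 2 * t * hs'
  have hD0 : 0 ≤ D := by
    rw [hN] at h
    have := pos_of_mul_pos_right h hb.le
    nlinarith [sq_nonneg (t₀ - s)]
  refine ⟨s - √D, s + √D, by linarith [Real.sqrt_nonneg D], fun t => ?_⟩
  rw [hN]
  linear_combination -(b₁ ^ 2 + b₂ ^ 2) * Real.sq_sqrt hD0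

theorem mem_Ioo_of_mul_pos {α β t : ℝ} (hαβ : α ≤ β) (h : 0 < (t - α) * (β - t)) : t ∈ Ioo α β := by
  rcases pos_and_pos_or_neg_and_neg_of_mul_pos h with ⟨h1, h2⟩ | ⟨h1, h2⟩
  · exact ⟨by linarith, by linarith⟩
  · linarith

theorem pos_of_ne_zero_of_continuousOn {f : ℝ → ℝ} (hT : T.OrdConnected) (hf : ContinuousOn f T)
    (h0 : ∀ t ∈ T, f t ≠ 0) {t₀ : ℝ} (ht₀ : t₀ ∈ T) (hpos : 0 < f t₀) {t : ℝ} (ht : t ∈ T) :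
    0 < f t := by
  by_contra! h
  obtain ⟨s, hs, hs0⟩ := hT.isPreconnected.intermediate_value ht ht₀ hf ⟨h, hpos.le⟩
  exact h0 s hs hs0

end ThreeBody
end

/-! ### The main theorem -/

theorem mainTheorem1 (m : Fin 3 → ℝ) (hm : ∀ a, 0 < m a) (γ : ℝ) (hγ : 0 < γ)
    (T : Set ℝ) (q : ℝ → Config) (hq : IsNewtonSolution m γ T q)
    (t₀ : ℝ) (ht₀ : t₀ ∈ T)
    (hH : energy m γ (q t₀) (velocity q t₀) = 0)
    (hI : deriv (fun t => momentOfInertia m (q t)) t₀ = 0)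
    (hJ : angularMomentum m (q t₀) (velocity q t₀) = 0)
    (hP : linearMomentum m (velocity q t₀) = 0) :
    ∃ S : Set ShapeSpace,
      (S = upperJemisphere (momentOfInertia m (q t₀)) ∨
        S = lowerJemisphere (momentOfInertia m (q t₀))) ∧
      IsJemGeodesic S T (fun t => shapeProj m (q t)) ∧
      ∃ A B C : ℝ, (A ≠ 0 ∨ B ≠ 0) ∧
        (fun t => shapeProj m (q t)) '' T ⊆ S ∩ verticalPlane A B C ∧
        (IsMaximalSolution m γ T q →
          (fun t => shapeProj m (q t)) '' T = S ∩ verticalPlane A B C) := by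
  obtain ⟨hi, a₁, b₁, a₂, b₂, hb, hw⟩ := hq.shapeProj_affine hm hγ ht₀ hH hI hJ hP
  set i := momentOfInertia m (q t₀)
  have hB : 0 < b₁ ^ 2 + b₂ ^ 2 := by
    rcases hb with h | h <;> positivity
  have hs₁ := scale₁_pos hm
  have hs₂ := scale₂_pos hm
  have harea : ∀ q, shapeProj m q 2 = 2 * √(m 0 * m 1 / (m 0 + m 1)) *
      √(m 2 * (m 0 + m 1) / (m 0 + m 1 + m 2)) * signedArea q := fun q => by
    rw [shapeProj_two, wedge_jacobi m hm]
  have hw₂0 : ∀ t ∈ T, shapeProj m (q t) 2 ≠ 0 := fun t ht => by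
    rw [harea]
    have := hq.area_ne_zero t ht
    positivity
  have hw₂ : ∀ t ∈ T, shapeProj m (q t) 2 ^ 2 =
      i ^ 2 / 4 - (a₁ + b₁ * t) ^ 2 - (a₂ + b₂ * t) ^ 2 := fun t ht => by
    have := shapeProj_norm_sq hm (q t)
    rw [hi t ht, (hw t ht).1, (hw t ht).2] at this
    linarith
  obtain ⟨α, β, hαβ, hN⟩ := sub_sq_sub_sq_eq_mul hB (r := i ^ 2 / 4) (a₁ := a₁) (a₂ := a₂)
    (t₀ := t₀) (by rw [← hw₂ t₀ ht₀]; have := hw₂0 t₀ ht₀; positivity)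
  have hTI : T ⊆ Set.Ioo α β := fun t ht => by
    refine mem_Ioo_of_mul_pos hαβ ((mul_pos_iff_of_pos_left hB).1 ?_)
    rw [← hN, ← hw₂ t ht]
    have := hw₂0 t ht
    positivity
  have hcont : ContinuousOn (fun t => shapeProj m (q t) 2) T := by
    simp only [harea]
    exact continuousOn_const.mul (contDiff_signedArea.continuous.comp_continuousOn fun t ht =>
      (hasDerivAt_pi.2 (hq.hasDerivAt ht)).continuousAt.continuousWithinAt)
  -- The sign `ε = ±1` of `w₃`, constant by connectedness of `T`, lets one argument treat both
  -- hemispheres.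
  obtain ⟨S, ε, hSor, hε, hS, hpos⟩ : ∃ (S : Set ShapeSpace) (ε : ℝ),
      (S = upperJemisphere i ∨ S = lowerJemisphere i) ∧ ε ^ 2 = 1 ∧
      (∀ w, w ∈ S ↔ w 0 ^ 2 + w 1 ^ 2 + w 2 ^ 2 = i ^ 2 / 4 ∧ 0 < ε * w 2) ∧
      ∀ t ∈ T, 0 < ε * shapeProj m (q t) 2 := by
    rcases lt_or_gt_of_ne (hw₂0 t₀ ht₀) with h | h
    · refine ⟨lowerJemisphere i, -1, Or.inr rfl, by norm_num, fun w => ?_, fun t ht => ?_⟩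
      · simp [lowerJemisphere]
      · rw [neg_one_mul]
        exact pos_of_ne_zero_of_continuousOn hq.ordConnected hcont.neg
          (fun s hs => neg_ne_zero.2 (hw₂0 s hs)) ht₀ (neg_pos.2 h) ht
    · refine ⟨upperJemisphere i, 1, Or.inl rfl, by norm_num, fun w => ?_, fun t ht => ?_⟩
      · simp [upperJemisphere]
      · rw [one_mul]
        exact pos_of_ne_zero_of_continuousOn hq.ordConnected hcont hw₂0 ht₀ h ht
  have hsqrt : ∀ {w x : ℝ}, 0 < ε * w → w ^ 2 = x → w = ε * √x := fun {w x} h1 h2 => by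
    have : √x = ε * w := by
      rw [← h2, ← Real.sqrt_sq h1.le, mul_pow, hε, one_mul]
    rw [this, ← mul_assoc, ← sq, hε, one_mul]
  have hcS : Set.MapsTo (fun t => shapeProj m (q t)) T S := fun t ht =>
    (hS _).2 ⟨by rw [shapeProj_norm_sq hm, hi t ht], hpos t ht⟩
  have hcd : ContDiffOn ℝ 1 (fun t => shapeProj m (q t)) T := by
    have haff : ∀ a b : ℝ, ContDiffOn ℝ 1 (fun t : ℝ => a + b * t) T := fun a b =>
      contDiffOn_const.add (contDiffOn_const.mul contDiffOn_id)
    refine contDiffOn_euclidean.2 fun k => ?_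
    fin_cases k
    · exact (haff a₁ b₁).congr fun t ht => (hw t ht).1
    · exact (haff a₂ b₂).congr fun t ht => (hw t ht).2
    · refine ContDiffOn.congr (contDiffOn_const.mul (ContDiffOn.sqrt
        ((contDiffOn_const.sub ((haff a₁ b₁).pow 2)).sub ((haff a₂ b₂).pow 2)) fun t ht => ?_))
        fun t ht => hsqrt (hpos t ht) (hw₂ t ht)
      simp only [← hw₂ t ht]
      exact pow_ne_zero 2 (hw₂0 t ht)
  -- The horizontal projection moves along `(b₁, b₂)` from `(a₁, a₂)`, so `(-b₂, b₁)` is normal to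
  -- the vertical plane.
  have himg : (fun t => shapeProj m (q t)) '' T ⊆
      S ∩ verticalPlane (-b₂) b₁ (-b₂ * a₁ + b₁ * a₂) := by
    rintro _ ⟨t, ht, rfl⟩
    refine ⟨hcS ht, ?_⟩
    simp only [verticalPlane, Set.mem_ofPred_eq, (hw t ht).1, (hw t ht).2]
    ring
  refine ⟨S, hSor, isJemGeodesic_of_affine hq.isOpen hB hTI (fun w hwS h0 => ?_) hcS hcd
    (fun t ht => (hw t ht).1) (fun t ht => (hw t ht).2) (fun t ht => (hw₂ t ht).trans (hN t)),
    -b₂, b₁, -b₂ * a₁ + b₁ * a₂, hb.symm.imp_left neg_ne_zero.2, himg,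
    fun hmax => himg.antisymm ?_⟩
  · have := ((hS w).1 hwS).2
    simp [h0] at this
  -- `T` is open, so by connectedness of `(α, β)` it suffices that `T` is relatively closed there.
  -- At a missing limit point `w₃²` has a positive limit, and the solution would extend, against
  -- maximality.
  have hIT : Set.Ioo α β ⊆ T := by
    refine isPreconnected_Ioo.subset_of_closure_inter_subset hq.isOpen ⟨t₀, hTI ht₀, ht₀⟩ ?_
    rintro t₁ ⟨ht₁, ht₁I⟩
    by_contra ht₁T
    set N : ℝ → ℝ := fun t => i ^ 2 / 4 - (a₁ + b₁ * t) ^ 2 - (a₂ + b₂ * t) ^ 2 with hNdef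
    have hN₁ : 0 < N t₁ := by
      rw [hNdef]
      simp only [hN]
      exact mul_pos hB (mul_pos (sub_pos.2 ht₁I.1) (sub_pos.2 ht₁I.2))
    have hNc : Continuous N := by fun_prop
    have hk : 0 < 2 * √(m 0 * m 1 / (m 0 + m 1)) * √(m 2 * (m 0 + m 1) / (m 0 + m 1 + m 2)) := by
      positivity
    obtain ⟨T', q', hq', hTT', heq, ht₁T'⟩ := hq.exists_extension hm hγ hi ht₁ ht₁T
      -- Near `t₁` one has `w₃² > N t₁ / 2`; dividing by the ratio of `w₃` to the signed area turns
      -- this into a lower bound for the area.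
      (ε := √(N t₁ / 2) / (2 * √(m 0 * m 1 / (m 0 + m 1)) *
        √(m 2 * (m 0 + m 1) / (m 0 + m 1 + m 2)))) (by positivity) (by
        filter_upwards [nhdsWithin_le_nhds ((hNc.tendsto t₁).eventually_const_lt
          (half_lt_self hN₁)), self_mem_nhdsWithin] with t ht htT
        rw [div_le_iff₀ hk, Real.sqrt_le_left (by positivity), mul_pow, sq_abs, ← mul_pow,
          mul_comm (signedArea _), ← harea, hw₂ t htT]
        exact ht.le)
    exact ht₁T (hmax.2 T' q' hq' hTT' heq ▸ ht₁T')
  rintro w ⟨hwS, hwp⟩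
  obtain ⟨hw1, hwpos⟩ := (hS w).1 hwS
  simp only [verticalPlane, Set.mem_ofPred_eq] at hwp
  -- The time is read off by projecting orthogonally onto the line; the equation of the plane shows
  -- that nothing is lost. The sign `ε` and the value of `w₃²` then determine `w₃`.
  set t := (b₁ * (w 0 - a₁) + b₂ * (w 1 - a₂)) / (b₁ ^ 2 + b₂ ^ 2) with ht
  have ht' : t * (b₁ ^ 2 + b₂ ^ 2) = b₁ * (w 0 - a₁) + b₂ * (w 1 - a₂) := by
    rw [ht]; field_simp
  have h0 : w 0 = a₁ + b₁ * t := by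
    refine mul_left_cancel₀ hB.ne' ?_
    linear_combination -b₁ * ht' - b₂ * hwp
  have h1 : w 1 = a₂ + b₂ * t := by
    refine mul_left_cancel₀ hB.ne' ?_
    linear_combination -b₂ * ht' + b₁ * hwp
  have h2 : w 2 ^ 2 = i ^ 2 / 4 - (a₁ + b₁ * t) ^ 2 - (a₂ + b₂ * t) ^ 2 := by
    rw [← h0, ← h1]; linarith
  have htT : t ∈ T := hIT (mem_Ioo_of_mul_pos hαβ
    ((mul_pos_iff_of_pos_left hB).1 (by
      rw [← hN, ← h2]
      exact sq_pos_of_ne_zero (right_ne_zero_of_mul hwpos.ne'))))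
  refine ⟨t, htT, ?_⟩
  ext k
  fin_cases k
  · exact (hw t htT).1.trans h0.symm
  · exact (hw t htT).2.trans h1.symm
  · exact (hsqrt (hpos t htT) (hw₂ t htT)).trans (hsqrt hwpos h2).symm
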